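/- All spaces are complex; forms and inner products are linear in the first and conjugate linear in the second argument. **Kreĭn spaces.** A space $(K,[\cdot,\cdot])$ with a Hermitian sesquilinear form is a Kreĭn space if it has a fundamental decomposition: a direct, $[\cdot,\cdot]$-orthogonal sum $K=K^+\oplus K^-$ such that $(K^+,[\cdot,\cdot])$ and $(K^-,-[\cdot,\cdot])$ are Hilbert spaces. If $P^\pm$ are the corresponding projections, $J=P^+-P^-$ is called a fundamental symmetry, and $\{\cdot,\cdot\}:=[J\cdot,\cdot]$ makes $K$ a Hilbert space, whose topology is the topology of the Kreĭn space. An operator $A$ in $K$ is J-self-adjoint (J-non-negative) if $JA$ is self-adjoint (non-negative) in $(K,\{\cdot,\cdot\})$; it is boundedly invertible if it has an everywhere defined bounded inverse. (These notions do not depend on $J$.) **Forms.** Let $\mathfrak t$ be a densely defined symmetric sesquilinear form in a Hilbert space $(H,(\cdot,\cdot))$, not necessarily semibounded. A number $\lambda\in\mathbb R$ is a gap point of $\mathfrak t$ if $(\operatorname{dom}\mathfrak t,\ \mathfrak t-\lambda(\cdot,\cdot))$ is a Kreĭn space that is continuously embedded in $H$; $\mathfrak t$ is closed if it has a gap point.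 The representing operator $T_{\mathfrak t}$ of a closed form is the unique self-adjoint operator in $H$ with $\operatorname{dom}T_{\mathfrak t}\subset\operatorname{dom}\mathfrak t$ and $\mathfrak t[u,v]=(T_{\mathfrak t}u,v)$ for $u\in\operatorname{dom}T_{\mathfrak t}$, $v\in\operatorname{dom}\mathfrak t$. Its range restriction $A_{\mathfrak t}$ is the operator in $\operatorname{dom}\mathfrak t$ with $\operatorname{dom}A_{\mathfrak t}=T_{\mathfrak t}^{-1}(\operatorname{dom}\mathfrak t)$ and $A_{\mathfrak t}f=T_{\mathfrak t}f$. **The two classes.** Let $\mathcal M$ be the class of all triples $(H,(\cdot,\cdot),\mathfrak t)$ where $(H,(\cdot,\cdot))$ is a Hilbert space and $\mathfrak t$ is a closed symmetric form in it with gap point $0$. Two such triples are identified if there is an isometric isomorphism $\phi:H_1\to H_2$ with $\phi(\operatorname{dom}\mathfrak t_1)=\operatorname{dom}\mathfrak t_2$ and $\mathfrak t_1[f,g]=\mathfrak t_2[\phi f,\phi g]$ for $f,g\in\operatorname{dom}\mathfrak t_1$. Let $\mathcal N$ be the class of all triples $(K,[\cdot,\cdot],A)$ where $(K,[\cdot,\cdot])$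 is a Kreĭn space and $A$ is J-non-negative, J-self-adjoint and boundedly invertible in it. Two such triples are identified if there is a linear bijection $\psi:K_1\to K_2$ with $[f,g]_1=[\psi f,\psi g]_2$ for $f,g\in K_1$, $\psi(\operatorname{dom}A_1)=\operatorname{dom}A_2$ and $A_1=\psi^{-1}A_2\psi$. **The space $K_-$.** For $(K,[\cdot,\cdot],A)\in\mathcal N$ and a fundamental symmetry $J$, let $K_+=\operatorname{dom}(JA)^{1/2}$ with $\{f,g\}_+=\{(JA)^{1/2}f,(JA)^{1/2}g\}$, where $(JA)^{1/2}$ is the unique non-negative self-adjoint square root of $JA$ in $(K,\{\cdot,\cdot\})$; this is a Hilbert space. Let $K_-$ be its dual, i.e. the space of all continuous linear functionals on $K_+$, with the scalar multiplication $(\alpha\varphi)(f)=\overline\alpha\,\varphi(f)$ and the dual norm. It is a Hilbert space with $\{\varphi,\psi\}_-=\psi(A_-^{-1}\varphi)$, where $A_-:K_+\to K_-$, $A_-g=\{\cdot,g\}_+$, is the Riesz isomorphism. The space $K$ is regarded as a subspace of $K_-$ through the injection $f\mapsto[\cdot,f]$. **Theorem.** Regard $\mathcal M$ and $\mathcal N$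 modulo the above identifications. Each closed symmetric form $\mathfrak t$ with gap point $0$ has a unique representing operator $T_{\mathfrak t}$, the triple $(\operatorname{dom}\mathfrak t,\mathfrak t,A_{\mathfrak t})$ belongs to $\mathcal N$, and the rule $$\Phi:\ (H,(\cdot,\cdot),\mathfrak t)\ \mapsto\ (\operatorname{dom}\mathfrak t,\ \mathfrak t,\ A_{\mathfrak t})$$ defines a bijection $\Phi$ from $\mathcal M$ to $\mathcal N$. For each $(K,[\cdot,\cdot],A)\in\mathcal N$ and each fundamental symmetry $J$, the inverse is given by $$\Phi^{-1}:\ (K,[\cdot,\cdot],A)\ \mapsto\ (K_-,\{\cdot,\cdot\}_-,\mathfrak t),\qquad \operatorname{dom}\mathfrak t=K\subset K_-,\quad \mathfrak t=[\cdot,\cdot],$$ and this triple belongs to $\mathcal M$. -/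

import Mathlib

open scoped ComplexConjugate

universe u

noncomputable section

namespace KreinForms

/-! Conventions: all spaces are complex. As usual in Mathlib, sesquilinear forms are linear in the
second argument, so `B x y` is the value written `[y, x]` when forms are linear in the first one. -/

/-- Sesquilinear forms (conjugate linear in the first, linear in the second argument). -/
abbrev SForm (V : Type u) [AddCommGroup V] [Module ℂ V] : Type u := V →ₗ⋆[ℂ] V →ₗ[ℂ] ℂ

section FormSpace

variable {V : Type u} [AddCommGroup V] [Module ℂ V]

/-- Symmetric (Hermitian) sesquilinear forms. -/
def IsSymmForm (B : SForm V) : Prop := ∀ x y, conj (B x y) = B y x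

/-- Positive definite inner products. -/
structure IsPosDefForm (B : SForm V) : Prop where
  symm : IsSymmForm B
  nonneg : ∀ x, 0 ≤ (B x x).re
  definite : ∀ x, B x x = 0 → x = 0

/-- The space `V` equipped with the norm and the inner product given by a positive definite
form `B`. -/
def FormSpace {B : SForm V} (_h : IsPosDefForm B) : Type u := V

/-- The inner product `B` as a Mathlib inner product. -/
@[reducible] def IsPosDefForm.core {B : SForm V} (h : IsPosDefForm B) :
    InnerProductSpace.Core ℂ V where
  inner x y := B x y
  conj_inner_symm x y := h.symm y x
  re_inner_nonneg x := h.nonneg x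
  add_left x y z := by simp
  smul_left x y r := by simp
  definite x hx := h.definite x hx

instance {B : SForm V} (h : IsPosDefForm B) : NormedAddCommGroup (FormSpace h) :=
  @InnerProductSpace.Core.toNormedAddCommGroup ℂ V _ _ _ h.core

instance {B : SForm V} (h : IsPosDefForm B) : InnerProductSpace ℂ (FormSpace h) :=
  @InnerProductSpace.ofCore ℂ V _ _ _ h.core.toCore

/-- The identity map from `V` to `FormSpace h`. -/
def FormSpace.of {B : SForm V} (h : IsPosDefForm B) : V ≃ₗ[ℂ] FormSpace h :=
  show V ≃ₗ[ℂ] V from LinearEquiv.refl ℂ V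

theorem FormSpace.inner_of {B : SForm V} (h : IsPosDefForm B) (x y : V) :
    inner ℂ (FormSpace.of h x) (FormSpace.of h y) = B x y := rfl

theorem FormSpace.norm_sq_of {B : SForm V} (h : IsPosDefForm B) (x : V) :
    ‖FormSpace.of h x‖ ^ 2 = (B x x).re :=
  norm_sq_eq_re_inner (𝕜 := ℂ) (FormSpace.of h x)

/-- `(V, B)` is a Hilbert space. -/
def IsHilbertForm (B : SForm V) : Prop := ∃ h : IsPosDefForm B, CompleteSpace (FormSpace h)

end FormSpace

section Krein

variable {K : Type u} [AddCommGroup K] [Module ℂ K]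

/-- The restriction of a form to a subspace. -/
def restrictForm (B : SForm K) (P : Submodule ℂ K) : SForm P :=
  (B.comp P.subtype).compl₂ P.subtype

/-- `K = P ⊕ N` is a fundamental decomposition of the indefinite inner product space `(K, B)`:
the sum is direct and `B`-orthogonal, `(P, B)` and `(N, -B)` are Hilbert spaces. -/
structure IsFundamentalDecomposition (B : SForm K) (P N : Submodule ℂ K) : Prop where
  symm : IsSymmForm B
  isCompl : IsCompl P N
  orthogonal : ∀ p ∈ P, ∀ n ∈ N, B p n = 0
  hilbert_pos : IsHilbertForm (restrictForm B P)
  hilbert_neg : IsHilbertForm (-restrictForm B N)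

/-- `J` is a fundamental symmetry of `(K, B)`: the difference of the two projections belonging to
a fundamental decomposition. -/
def IsFundamentalSymmetry (B : SForm K) (J : K →ₗ[ℂ] K) : Prop :=
  ∃ P N : Submodule ℂ K, IsFundamentalDecomposition B P N ∧
    (∀ p ∈ P, J p = p) ∧ (∀ n ∈ N, J n = -n)

/-- `(K, B)` is a Kreĭn space. -/
def IsKreinForm (B : SForm K) : Prop :=
  ∃ P N : Submodule ℂ K, IsFundamentalDecomposition B P N

/-- The form `{x, y} = [J x, y]`. -/
def jForm (B : SForm K) (J : K →ₗ[ℂ] K) : SForm K := B.comp J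

theorem decomp_add {P N : Submodule ℂ K} (h : IsCompl P N) (x : K) :
    ∃ p ∈ P, ∃ n ∈ N, x = p + n := by
  have hx : x ∈ P ⊔ N := by rw [h.sup_eq_top]; trivial
  obtain ⟨p, hp, n, hn, e⟩ := Submodule.mem_sup.1 hx
  exact ⟨p, hp, n, hn, e.symm⟩

theorem IsFundamentalSymmetry.involutive {B : SForm K} {J : K →ₗ[ℂ] K}
    (h : IsFundamentalSymmetry B J) (x : K) : J (J x) = x := by
  obtain ⟨P, N, hd, hP, hN⟩ := h
  obtain ⟨p, hp, n, hn, rfl⟩ := decomp_add hd.isCompl x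
  simp [hP p hp, hN n hn]

theorem jForm_decomp {B : SForm K} {J : K →ₗ[ℂ] K} {P N : Submodule ℂ K}
    (hd : IsFundamentalDecomposition B P N) (hP : ∀ p ∈ P, J p = p) (hN : ∀ n ∈ N, J n = -n)
    {p p' n n' : K} (hp : p ∈ P) (hp' : p' ∈ P) (hn : n ∈ N) (hn' : n' ∈ N) :
    jForm B J (p + n) (p' + n') = B p p' - B n n' := by
  have h2 : B n p' = 0 := by
    rw [← hd.symm p' n, hd.orthogonal p' hp' n hn, map_zero]
  simp [jForm, hP p hp, hN n hn, hd.orthogonal p hp n' hn', h2, sub_eq_add_neg]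

theorem IsFundamentalSymmetry.isPosDefForm {B : SForm K} {J : K →ₗ[ℂ] K}
    (h : IsFundamentalSymmetry B J) : IsPosDefForm (jForm B J) := by
  obtain ⟨P, N, hd, hP, hN⟩ := h
  obtain ⟨pp, -⟩ := hd.hilbert_pos
  obtain ⟨pn, -⟩ := hd.hilbert_neg
  have e1 : ∀ p ∈ P, 0 ≤ (B p p).re := fun p hp => pp.nonneg ⟨p, hp⟩
  have e2 : ∀ n ∈ N, 0 ≤ -(B n n).re := fun n hn => by
    simpa [restrictForm] using pn.nonneg ⟨n, hn⟩
  have im0 : ∀ x, (B x x).im = 0 := fun x => Complex.conj_eq_iff_im.1 (hd.symm x x)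
  refine ⟨fun x y => ?_, fun x => ?_, fun x hx => ?_⟩
  · obtain ⟨p, hp, n, hn, rfl⟩ := decomp_add hd.isCompl x
    obtain ⟨p', hp', n', hn', rfl⟩ := decomp_add hd.isCompl y
    rw [jForm_decomp hd hP hN hp hp' hn hn', jForm_decomp hd hP hN hp' hp hn' hn, map_sub,
      hd.symm, hd.symm]
  · obtain ⟨p, hp, n, hn, rfl⟩ := decomp_add hd.isCompl x
    rw [jForm_decomp hd hP hN hp hp hn hn, Complex.sub_re]
    linarith [e1 p hp, e2 n hn]
  · obtain ⟨p, hp, n, hn, rfl⟩ := decomp_add hd.isCompl x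
    rw [jForm_decomp hd hP hN hp hp hn hn] at hx
    have hre := congrArg Complex.re hx
    rw [Complex.sub_re, Complex.zero_re] at hre
    have hp0 : p = 0 := by
      have := pp.definite ⟨p, hp⟩ (Complex.ext (by
        change (B p p).re = 0
        linarith [e1 p hp, e2 n hn]) (im0 p))
      exact congrArg Subtype.val this
    have hn0 : n = 0 := by
      have := pn.definite ⟨n, hn⟩ (by
        change -(B n n) = 0
        rw [neg_eq_zero]
        exact Complex.ext (by rw [Complex.zero_re]; linarith [e1 p hp, e2 n hn]) (im0 n))
      exact congrArg Subtype.val this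
    rw [hp0, hn0, add_zero]

/-- The Hilbert space `(K, {·, ·})` belonging to a fundamental symmetry `J`. -/
abbrev JSpace {B : SForm K} {J : K →ₗ[ℂ] K} (h : IsFundamentalSymmetry B J) : Type u :=
  FormSpace h.isPosDefForm

/-- The identity map from `K` to the Hilbert space `(K, {·, ·})`. -/
abbrev JSpace.of {B : SForm K} {J : K →ₗ[ℂ] K} (h : IsFundamentalSymmetry B J) :
    K ≃ₗ[ℂ] JSpace h := FormSpace.of h.isPosDefForm

theorem completeSpace_of_sum {P N E : Type*} [NormedAddCommGroup P] [NormedSpace ℂ P]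
    [NormedAddCommGroup N] [NormedSpace ℂ N] [NormedAddCommGroup E]
    [CompleteSpace P] [CompleteSpace N] (f : P → E) (g : N → E)
    (hs : ∀ x, ∃ p n, x = f p + g n)
    (h1 : ∀ p n p' n', ‖p - p'‖ ≤ ‖f p + g n - (f p' + g n')‖)
    (h2 : ∀ p n p' n', ‖n - n'‖ ≤ ‖f p + g n - (f p' + g n')‖)
    (h3 : ∀ p n p' n', ‖f p + g n - (f p' + g n')‖ ≤ ‖p - p'‖ + ‖n - n'‖) :
    CompleteSpace E := by
  refine Metric.complete_of_cauchySeq_tendsto fun u hu => ?_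
  choose p n e using fun k => hs (u k)
  rw [Metric.cauchySeq_iff] at hu
  have cp : CauchySeq p := Metric.cauchySeq_iff.2 fun ε hε => by
    obtain ⟨M, hM⟩ := hu ε hε
    refine ⟨M, fun a ha b hb => lt_of_le_of_lt ?_ (hM a ha b hb)⟩
    rw [dist_eq_norm, dist_eq_norm, e a, e b]
    exact h1 _ _ _ _
  have cn : CauchySeq n := Metric.cauchySeq_iff.2 fun ε hε => by
    obtain ⟨M, hM⟩ := hu ε hε
    refine ⟨M, fun a ha b hb => lt_of_le_of_lt ?_ (hM a ha b hb)⟩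
    rw [dist_eq_norm, dist_eq_norm, e a, e b]
    exact h2 _ _ _ _
  obtain ⟨p₀, hp₀⟩ := cauchySeq_tendsto_of_complete cp
  obtain ⟨n₀, hn₀⟩ := cauchySeq_tendsto_of_complete cn
  refine ⟨f p₀ + g n₀, ?_⟩
  rw [tendsto_iff_norm_sub_tendsto_zero] at hp₀ hn₀ ⊢
  refine squeeze_zero (fun _ => norm_nonneg _) (fun k => ?_) (by simpa using hp₀.add hn₀)
  rw [e k]
  exact h3 _ _ _ _

instance {B : SForm K} {J : K →ₗ[ℂ] K} (h : IsFundamentalSymmetry B J) :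
    CompleteSpace (JSpace h) := by
  have h0 := h
  obtain ⟨P, N, hd, hP, hN⟩ := h0
  obtain ⟨pp, cP⟩ := hd.hilbert_pos
  obtain ⟨pn, cN⟩ := hd.hilbert_neg
  have nP : ∀ p : P, ‖FormSpace.of pp p‖ ^ 2 = (B p p).re := fun p =>
    FormSpace.norm_sq_of pp p
  have nN : ∀ n : N, ‖FormSpace.of pn n‖ ^ 2 = -(B n n).re := fun n =>
    FormSpace.norm_sq_of pn n
  have key : ∀ (p : P) (n : N), ‖JSpace.of h (p + n)‖ ^ 2
      = ‖FormSpace.of pp p‖ ^ 2 + ‖FormSpace.of pn n‖ ^ 2 := by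
    intro p n
    rw [nP, nN, FormSpace.norm_sq_of,
      jForm_decomp hd hP hN p.2 p.2 n.2 n.2, ← sub_eq_add_neg, Complex.sub_re]
  let f : FormSpace pp →ₗ[ℂ] JSpace h :=
    (JSpace.of h).toLinearMap ∘ₗ P.subtype ∘ₗ (FormSpace.of pp).symm.toLinearMap
  let g : FormSpace pn →ₗ[ℂ] JSpace h :=
    (JSpace.of h).toLinearMap ∘ₗ N.subtype ∘ₗ (FormSpace.of pn).symm.toLinearMap
  have key2 : ∀ (p p' : FormSpace pp) (n n' : FormSpace pn),
      ‖f p + g n - (f p' + g n')‖ ^ 2 = ‖p - p'‖ ^ 2 + ‖n - n'‖ ^ 2 := by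
    intro p p' n n'
    have h1 := key ((FormSpace.of pp).symm (p - p')) ((FormSpace.of pn).symm (n - n'))
    rw [LinearEquiv.apply_symm_apply, LinearEquiv.apply_symm_apply] at h1
    rw [← h1, add_sub_add_comm, ← map_sub, ← map_sub, map_add]
    rfl
  refine completeSpace_of_sum f g
    (fun x => ?_) (fun p n p' n' => ?_) (fun p n p' n' => ?_) (fun p n p' n' => ?_)
  · obtain ⟨p, hp, n, hn, e⟩ := decomp_add hd.isCompl ((JSpace.of h).symm x)
    exact ⟨FormSpace.of pp ⟨p, hp⟩, FormSpace.of pn ⟨n, hn⟩, e⟩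
  · refine abs_le_of_sq_le_sq' ?_ (norm_nonneg _) |>.2
    rw [key2]; linarith [sq_nonneg ‖n - n'‖]
  · refine abs_le_of_sq_le_sq' ?_ (norm_nonneg _) |>.2
    rw [key2]; linarith [sq_nonneg ‖p - p'‖]
  · refine abs_le_of_sq_le_sq' ?_ (by positivity) |>.2
    rw [key2]; nlinarith [mul_nonneg (norm_nonneg (p - p')) (norm_nonneg (n - n'))]

end Krein

section Operators

variable {E : Type u} [NormedAddCommGroup E] [InnerProductSpace ℂ E]

/-- Non-negative operators in an inner product space. -/
def IsNonnegOp (T : E →ₗ.[ℂ] E) : Prop := ∀ x : T.domain, 0 ≤ (inner ℂ (x : E) (T x)).re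

/-- `T` has an everywhere defined bounded inverse. -/
def IsBoundedlyInvertible (T : E →ₗ.[ℂ] E) : Prop :=
  ∃ R : E →L[ℂ] E, (∀ x : T.domain, R (T x) = x) ∧
    ∀ y : E, ∃ h : R y ∈ T.domain, T ⟨R y, h⟩ = y

/-- `S = T ^ (1/2)`: `S` is self-adjoint and non-negative, and `S ∘ S = T` including domains. -/
structure IsNonnegSqrt [CompleteSpace E] (S T : E →ₗ.[ℂ] E) : Prop where
  selfAdjoint : IsSelfAdjoint S
  nonneg : IsNonnegOp S
  sq : ∀ x y : E, (x, y) ∈ T.graph ↔ ∃ z, (x, z) ∈ S.graph ∧ (z, y) ∈ S.graph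

/-- A self-adjoint operator in `E` that is a bijection from its domain onto `E`. -/
structure IsBijSelfAdjoint [CompleteSpace E] (S : E →ₗ.[ℂ] E) : Prop where
  selfAdjoint : IsSelfAdjoint S
  bij : Function.Bijective S

theorem IsNonnegSqrt.isBijSelfAdjoint [CompleteSpace E] {S T : E →ₗ.[ℂ] E}
    (h : IsNonnegSqrt S T) (hT : Function.Bijective T) : IsBijSelfAdjoint S := by
  refine ⟨h.selfAdjoint, ?_, fun y => ?_⟩
  · intro a b hab
    have hc : S (a - b) = 0 := by rw [LinearPMap.map_sub, hab, sub_self]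
    have hm : (((a - b : S.domain) : E), (0 : E)) ∈ S.graph := by
      rw [← hc]; exact S.mem_graph (a - b)
    have hT0 := (h.sq ((a - b : S.domain) : E) 0).2 ⟨0, hm, S.graph.zero_mem⟩
    obtain ⟨x, hx1, hx2⟩ := (LinearPMap.mem_graph_iff T).1 hT0
    have : x = 0 := hT.1 (by rw [LinearPMap.map_zero]; exact hx2)
    rw [this] at hx1
    have h0 : ((a - b : S.domain) : E) = 0 := hx1.symm
    exact sub_eq_zero.1 (Subtype.ext h0)
  · obtain ⟨x, hx⟩ := hT.2 y
    have hm : ((x : E), y) ∈ T.graph := by rw [← hx]; exact T.mem_graph x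
    obtain ⟨z, -, hz⟩ := (h.sq _ _).1 hm
    obtain ⟨w, -, hw⟩ := (LinearPMap.mem_graph_iff S).1 hz
    exact ⟨w, hw⟩

/-- The form `{f, g}₊ = {S f, S g}` on `dom S`. -/
def plusForm (S : E →ₗ.[ℂ] E) : SForm S.domain :=
  ((innerₛₗ ℂ).comp S.toFun).compl₂ S.toFun

theorem plusForm_apply (S : E →ₗ.[ℂ] E) (x y : S.domain) :
    plusForm S x y = inner ℂ (S x) (S y) := rfl

variable [CompleteSpace E]

theorem IsBijSelfAdjoint.isPosDefForm {S : E →ₗ.[ℂ] E} (hS : IsBijSelfAdjoint S) :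
    IsPosDefForm (plusForm S) := by
  refine ⟨fun x y => ?_, fun x => ?_, fun x hx => ?_⟩
  · rw [plusForm_apply, plusForm_apply, inner_conj_symm]
  · rw [plusForm_apply]
    exact inner_self_nonneg (𝕜 := ℂ)
  · rw [plusForm_apply, inner_self_eq_zero] at hx
    exact hS.bij.1 (by rw [hx, LinearPMap.map_zero])

/-- The space `K₊ = (dom S, {S ·, S ·})`. -/
abbrev KPlus {S : E →ₗ.[ℂ] E} (hS : IsBijSelfAdjoint S) : Type u := FormSpace hS.isPosDefForm

/-- The identity map from `dom S` to `K₊`. -/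
abbrev KPlus.of {S : E →ₗ.[ℂ] E} (hS : IsBijSelfAdjoint S) : S.domain ≃ₗ[ℂ] KPlus hS :=
  FormSpace.of hS.isPosDefForm

/-- `S` as an isometry from `K₊` onto the ambient Hilbert space. -/
def IsBijSelfAdjoint.isometry {S : E →ₗ.[ℂ] E} (hS : IsBijSelfAdjoint S) :
    KPlus hS ≃ₗᵢ[ℂ] E where
  toLinearEquiv := (KPlus.of hS).symm.trans (LinearEquiv.ofBijective S.toFun hS.bij)
  norm_map' x := by
    obtain ⟨y, rfl⟩ := (KPlus.of hS).surjective x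
    have h : ‖S y‖ ^ 2 = ‖KPlus.of hS y‖ ^ 2 := by
      rw [@norm_sq_eq_re_inner ℂ, FormSpace.norm_sq_of, plusForm_apply]
      rfl
    exact (sq_eq_sq₀ (norm_nonneg _) (norm_nonneg _)).1 h

instance {S : E →ₗ.[ℂ] E} (hS : IsBijSelfAdjoint S) : CompleteSpace (KPlus hS) :=
  hS.isometry.symm.isometry.isUniformInducing.completeSpace_congr
    hS.isometry.symm.surjective |>.1 inferInstance

/-- The embedding of `K₊` into the ambient Hilbert space. -/
def KPlus.incl {S : E →ₗ.[ℂ] E} (hS : IsBijSelfAdjoint S) : KPlus hS →ₗ[ℂ] E :=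
  S.domain.subtype ∘ₗ (KPlus.of hS).symm.toLinearMap

theorem KPlus.continuous_incl {S : E →ₗ.[ℂ] E} (hS : IsBijSelfAdjoint S) :
    Continuous (KPlus.incl hS) := by
  have hsymm : ∀ x y : S.domain, inner ℂ (S x) (y : E) = inner ℂ (x : E) (S y) := by
    intro x y
    have h1 := LinearPMap.adjoint_isFormalAdjoint hS.selfAdjoint.dense_domain
    rw [LinearPMap.isSelfAdjoint_def.1 hS.selfAdjoint] at h1
    exact h1 x y
  let R : E →ₗ[ℂ] E := (KPlus.incl hS).comp hS.isometry.symm.toLinearEquiv.toLinearMap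
  have hR : R.IsSymmetric := by
    intro x y
    obtain ⟨a, rfl⟩ := hS.isometry.surjective x
    obtain ⟨b, rfl⟩ := hS.isometry.surjective y
    have ea : R (hS.isometry a) = KPlus.incl hS a :=
      congrArg (KPlus.incl hS) (hS.isometry.symm_apply_apply a)
    have eb : R (hS.isometry b) = KPlus.incl hS b :=
      congrArg (KPlus.incl hS) (hS.isometry.symm_apply_apply b)
    rw [ea, eb]
    exact (hsymm a b).symm
  have hc := hR.continuous.comp hS.isometry.continuous
  have : (KPlus.incl hS : KPlus hS → E) = R ∘ hS.isometry := by
    funext a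
    exact (congrArg (KPlus.incl hS) (hS.isometry.symm_apply_apply a)).symm
  rw [this]
  exact hc

/-- The dual space `K₋` of `K₊`: continuous linear functionals with the dual norm, where the
scalar multiplication is `(α • φ) f = conj α * φ f`. -/
def KMinus {S : E →ₗ.[ℂ] E} (hS : IsBijSelfAdjoint S) : Type u := StrongDual ℂ (KPlus hS)

instance {S : E →ₗ.[ℂ] E} (hS : IsBijSelfAdjoint S) : NormedAddCommGroup (KMinus hS) :=
  inferInstanceAs (NormedAddCommGroup (StrongDual ℂ (KPlus hS)))

instance {S : E →ₗ.[ℂ] E} (hS : IsBijSelfAdjoint S) : CompleteSpace (KMinus hS) :=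
  inferInstanceAs (CompleteSpace (StrongDual ℂ (KPlus hS)))

/-- Evaluation of an element of `K₋` at an element of `K₊`. -/
def KMinus.eval {S : E →ₗ.[ℂ] E} {hS : IsBijSelfAdjoint S} (φ : KMinus hS) :
    StrongDual ℂ (KPlus hS) := φ

/-- The inverse of the Riesz isomorphism `A₋ : K₊ → K₋`, `A₋ g = {·, g}₊`. -/
def KMinus.rieszInv {S : E →ₗ.[ℂ] E} {hS : IsBijSelfAdjoint S} (φ : KMinus hS) : KPlus hS :=
  (InnerProductSpace.toDual ℂ (KPlus hS)).symm φ.eval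

instance {S : E →ₗ.[ℂ] E} (hS : IsBijSelfAdjoint S) : Module ℂ (KMinus hS) :=
  Module.compHom (StrongDual ℂ (KPlus hS)) (starRingEnd ℂ)

/-- `K₋` is a Hilbert space with `{φ, ψ}₋ = ψ (A₋⁻¹ φ)`; the norm is the dual norm. -/
instance {S : E →ₗ.[ℂ] E} (hS : IsBijSelfAdjoint S) : InnerProductSpace ℂ (KMinus hS) where
  inner φ ψ := φ.eval ψ.rieszInv
  norm_smul_le a φ :=
    (norm_smul_le (conj a) φ.eval).trans (by rw [RCLike.norm_conj]; rfl)
  norm_sq_eq_re_inner φ := by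
    obtain ⟨f, hf⟩ := (InnerProductSpace.toDual ℂ (KPlus hS)).surjective φ.eval
    have e1 : φ.rieszInv = f := by
      rw [KMinus.rieszInv, ← hf, LinearIsometryEquiv.symm_apply_apply]
    have e2 : ‖φ‖ = ‖f‖ := by
      change ‖φ.eval‖ = ‖f‖
      rw [← hf, LinearIsometryEquiv.norm_map]
    rw [e1, e2, ← hf, InnerProductSpace.toDual_apply_apply, ← norm_sq_eq_re_inner]
  conj_inner_symm φ ψ := by
    obtain ⟨f, hf⟩ := (InnerProductSpace.toDual ℂ (KPlus hS)).surjective φ.eval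
    obtain ⟨g, hg⟩ := (InnerProductSpace.toDual ℂ (KPlus hS)).surjective ψ.eval
    have e1 : φ.rieszInv = f := by
      rw [KMinus.rieszInv, ← hf, LinearIsometryEquiv.symm_apply_apply]
    have e2 : ψ.rieszInv = g := by
      rw [KMinus.rieszInv, ← hg, LinearIsometryEquiv.symm_apply_apply]
    rw [e1, e2, ← hf, ← hg, InnerProductSpace.toDual_apply_apply,
      InnerProductSpace.toDual_apply_apply, inner_conj_symm]
  add_left φ ψ χ := rfl
  smul_left φ ψ a := rfl

end Operators

/-! ### The class of closed symmetric forms with gap point `0` -/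

/-- A Hilbert space `H` together with a sesquilinear form on a subspace of `H`. -/
structure FormTriple : Type (u + 1) where
  H : Type u
  [normed : NormedAddCommGroup H]
  [ips : InnerProductSpace ℂ H]
  [complete : CompleteSpace H]
  dom : Submodule ℂ H
  form : SForm dom

attribute [instance] FormTriple.normed FormTriple.ips FormTriple.complete

namespace FormTriple

/-- The shifted form `𝔱 - lam (·, ·)`. -/
def shift (X : FormTriple.{u}) (lam : ℝ) : SForm X.dom :=
  X.form - (lam : ℂ) • restrictForm (innerₛₗ ℂ) X.dom

/-- `lam` is a gap point: `(dom 𝔱, 𝔱 - lam (·, ·))` is a Kreĭn space which is continuously embedded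
in `H`. -/
def IsGapPoint (X : FormTriple.{u}) (lam : ℝ) : Prop :=
  IsKreinForm (X.shift lam) ∧
    ∀ (J : X.dom →ₗ[ℂ] X.dom) (hJ : IsFundamentalSymmetry (X.shift lam) J),
      Continuous (fun x : JSpace hJ => (((JSpace.of hJ).symm x : X.dom) : X.H))

/-- Closedness of a form. -/
def IsClosedForm (X : FormTriple.{u}) : Prop := ∃ lam : ℝ, X.IsGapPoint lam

/-- The form is densely defined, symmetric and closed, with gap point `0`. -/
structure IsClosedSymmGapZero (X : FormTriple.{u}) : Prop where
  dense : Dense (X.dom : Set X.H)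
  symm : IsSymmForm X.form
  closed : X.IsClosedForm
  gap : X.IsGapPoint 0

/-- `T` is the representing operator of the form: `T` is self-adjoint, `dom T ⊆ dom 𝔱` and
`𝔱[u, v] = (T u, v)` for `u ∈ dom T`, `v ∈ dom 𝔱`. -/
structure IsRepresentingOperator (X : FormTriple.{u}) (T : X.H →ₗ.[ℂ] X.H) : Prop where
  selfAdjoint : IsSelfAdjoint T
  domain_le : T.domain ≤ X.dom
  represents : ∀ (x : T.domain) (v : X.dom),
    X.form v ⟨x, domain_le x.2⟩ = inner ℂ (v : X.H) (T x)

/-- Isometric identification of two triples. -/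
def Identified (X Y : FormTriple.{u}) : Prop :=
  ∃ e : X.H ≃ₗᵢ[ℂ] Y.H, (∀ x, x ∈ X.dom ↔ e x ∈ Y.dom) ∧
    ∀ (f g : X.dom) (f' g' : Y.dom), (f' : Y.H) = e f → (g' : Y.H) = e g →
      X.form f g = Y.form f' g'

end FormTriple

/-- The range restriction of `T` to `D`: its domain is `{x ∈ D ∩ dom T | T x ∈ D}`
(which is `T⁻¹(D)` if `dom T ⊆ D`), and it acts in `D`. -/
def rangeRestriction {H : Type u} [AddCommGroup H] [Module ℂ H] (D : Submodule ℂ H)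
    (T : H →ₗ.[ℂ] H) : D →ₗ.[ℂ] D where
  domain :=
    { carrier := {x | ∃ h : (x : H) ∈ T.domain, T ⟨x, h⟩ ∈ D}
      zero_mem' := ⟨T.domain.zero_mem, by
        have : T ⟨0, T.domain.zero_mem⟩ = 0 := T.map_zero
        change T ⟨0, _⟩ ∈ D
        rw [this]; exact D.zero_mem⟩
      add_mem' := by
        rintro a b ⟨ha, ha'⟩ ⟨hb, hb'⟩
        refine ⟨T.domain.add_mem ha hb, ?_⟩
        have : T ⟨(a : H) + b, T.domain.add_mem ha hb⟩ = T ⟨a, ha⟩ + T ⟨b, hb⟩ :=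
          T.map_add ⟨a, ha⟩ ⟨b, hb⟩
        change T ⟨(a : H) + b, _⟩ ∈ D
        rw [this]; exact D.add_mem ha' hb'
      smul_mem' := by
        rintro c a ⟨ha, ha'⟩
        refine ⟨T.domain.smul_mem c ha, ?_⟩
        have : T ⟨c • (a : H), T.domain.smul_mem c ha⟩ = c • T ⟨a, ha⟩ := T.map_smul c ⟨a, ha⟩
        change T ⟨c • (a : H), _⟩ ∈ D
        rw [this]; exact D.smul_mem c ha' }
  toFun :=
    { toFun := fun x => ⟨T ⟨((x : D) : H), x.2.choose⟩, x.2.choose_spec⟩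
      map_add' := fun x y => Subtype.ext
        (T.map_add ⟨((x : D) : H), x.2.choose⟩ ⟨((y : D) : H), y.2.choose⟩)
      map_smul' := fun c x => Subtype.ext (T.map_smul c ⟨((x : D) : H), x.2.choose⟩) }

/-! ### The class of J-non-negative, J-self-adjoint, boundedly invertible operators -/

/-- A complex vector space with a sesquilinear form and an operator. -/
structure OpTriple : Type (u + 1) where
  K : Type u
  [addCommGroup : AddCommGroup K]
  [module : Module ℂ K]
  form : SForm K
  A : K →ₗ.[ℂ] K

attribute [instance] OpTriple.addCommGroup OpTriple.module

namespace OpTriple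

/-- The operator `A`, regarded in the Hilbert space given by the fundamental symmetry `J`. -/
def opA (Y : OpTriple.{u}) {J : Y.K →ₗ[ℂ] Y.K} (hJ : IsFundamentalSymmetry Y.form J) :
    JSpace hJ →ₗ.[ℂ] JSpace hJ := show Y.K →ₗ.[ℂ] Y.K from Y.A

/-- The operator `J A` in the Hilbert space given by the fundamental symmetry `J`. -/
def opJA (Y : OpTriple.{u}) {J : Y.K →ₗ[ℂ] Y.K} (hJ : IsFundamentalSymmetry Y.form J) :
    JSpace hJ →ₗ.[ℂ] JSpace hJ := show Y.K →ₗ.[ℂ] Y.K from J.compPMap Y.A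

/-- `(K, [·, ·])` is a Kreĭn space and `A` is J-self-adjoint, J-non-negative and boundedly
invertible in it. (The last three properties do not depend on the fundamental symmetry.) -/
structure IsJNonnegOperator (Y : OpTriple.{u}) : Prop where
  krein : IsKreinForm Y.form
  selfAdjoint : ∀ (J : Y.K →ₗ[ℂ] Y.K) (hJ : IsFundamentalSymmetry Y.form J),
    IsSelfAdjoint (Y.opJA hJ)
  nonneg : ∀ (J : Y.K →ₗ[ℂ] Y.K) (hJ : IsFundamentalSymmetry Y.form J), IsNonnegOp (Y.opJA hJ)
  invertible : ∀ (J : Y.K →ₗ[ℂ] Y.K) (hJ : IsFundamentalSymmetry Y.form J),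
    IsBoundedlyInvertible (Y.opA hJ)

/-- Isometric identification of two triples. -/
def Identified (X Y : OpTriple.{u}) : Prop :=
  ∃ e : X.K ≃ₗ[ℂ] Y.K, (∀ x y, X.form x y = Y.form (e x) (e y)) ∧
    (∀ x, x ∈ X.A.domain ↔ e x ∈ Y.A.domain) ∧
    ∀ (x : X.A.domain) (x' : Y.A.domain), (x' : Y.K) = e x → Y.A x' = e (X.A x)

theorem IsJNonnegOperator.bijective {Y : OpTriple.{u}} (hY : Y.IsJNonnegOperator)
    {J : Y.K →ₗ[ℂ] Y.K} (hJ : IsFundamentalSymmetry Y.form J) :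
    Function.Bijective (Y.opJA hJ) := by
  obtain ⟨R, h1, h2⟩ := hY.invertible J hJ
  constructor
  · intro a b hab
    have h3 : Y.A a = Y.A b := by
      have := congrArg J (show J (Y.A a) = J (Y.A b) from hab)
      rwa [hJ.involutive, hJ.involutive] at this
    exact Subtype.ext ((h1 a).symm.trans ((congrArg R h3).trans (h1 b)))
  · intro y
    obtain ⟨h, e⟩ := h2 (J y)
    exact ⟨⟨R (J y), h⟩, (congrArg J e).trans (hJ.involutive y)⟩

/-- For `S = (J A) ^ (1/2)`: the data needed to form `K₊ = dom S` and its dual `K₋`. -/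
theorem IsJNonnegOperator.sqrt_bij {Y : OpTriple.{u}} (hY : Y.IsJNonnegOperator)
    {J : Y.K →ₗ[ℂ] Y.K} {hJ : IsFundamentalSymmetry Y.form J}
    {S : JSpace hJ →ₗ.[ℂ] JSpace hJ} (hS : IsNonnegSqrt S (Y.opJA hJ)) : IsBijSelfAdjoint S :=
  hS.isBijSelfAdjoint (hY.bijective hJ)

section Embedding

variable {Y : OpTriple.{u}} {J : Y.K →ₗ[ℂ] Y.K} {hJ : IsFundamentalSymmetry Y.form J}
  {S : JSpace hJ →ₗ.[ℂ] JSpace hJ}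

theorem form_eq_inner (hJ : IsFundamentalSymmetry Y.form J) (f x : Y.K) :
    Y.form f x = inner ℂ (JSpace.of hJ (J f)) (JSpace.of hJ x) := by
  rw [FormSpace.inner_of]
  change Y.form f x = Y.form (J (J f)) x
  rw [hJ.involutive]

/-- The functional `[·, f]` on `K₊`, for `f ∈ K`. -/
def functional (hS : IsBijSelfAdjoint S) (f : Y.K) : StrongDual ℂ (KPlus hS) where
  toLinearMap := Y.form f ∘ₗ (JSpace.of hJ).symm.toLinearMap ∘ₗ KPlus.incl hS
  cont := by
    have h : (fun x : KPlus hS => Y.form f ((JSpace.of hJ).symm (KPlus.incl hS x))) =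
        fun x => inner ℂ (JSpace.of hJ (J f)) (KPlus.incl hS x) :=
      funext fun x => by rw [form_eq_inner hJ, LinearEquiv.apply_symm_apply]
    change Continuous (fun x : KPlus hS => Y.form f ((JSpace.of hJ).symm (KPlus.incl hS x)))
    rw [h]
    exact continuous_const.inner (KPlus.continuous_incl hS)

theorem functional_apply (hS : IsBijSelfAdjoint S) (f : Y.K) (x : KPlus hS) :
    functional hS f x = Y.form f ((JSpace.of hJ).symm (KPlus.incl hS x)) := rfl

/-- The embedding `f ↦ [·, f]` of `K` into `K₋`. -/
def embed (hS : IsBijSelfAdjoint S) : Y.K →ₗ[ℂ] KMinus hS where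
  toFun f := functional hS f
  map_add' f g := ContinuousLinearMap.ext fun x => by
    change functional hS (f + g) x = functional hS f x + functional hS g x
    simp only [functional_apply, map_add, LinearMap.add_apply]
  map_smul' c f := ContinuousLinearMap.ext fun x => by
    change functional hS (c • f) x = conj c * functional hS f x
    simp only [functional_apply, LinearMap.map_smulₛₗ, LinearMap.smul_apply, smul_eq_mul]

theorem embed_injective (hS : IsBijSelfAdjoint S) :
    Function.Injective (embed hS) := by
  rw [injective_iff_map_eq_zero]
  intro f hf
  have h1 : ∀ x ∈ S.domain, inner ℂ (JSpace.of hJ (J f)) x = 0 := by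
    intro x hx
    have h2 := form_eq_inner hJ f ((JSpace.of hJ).symm x)
    rw [LinearEquiv.apply_symm_apply] at h2
    rw [← h2]
    exact congrArg (fun φ : StrongDual ℂ (KPlus hS) => φ (KPlus.of hS ⟨x, hx⟩)) hf
  have h2 : JSpace.of hJ (J f) = 0 :=
    hS.selfAdjoint.dense_domain.eq_zero_of_inner_left ℂ h1
  rw [LinearEquiv.map_eq_zero_iff] at h2
  rw [← hJ.involutive f, h2, map_zero]

/-- The identification of `K` with its image in `K₋`. -/
def embedEquiv (hS : IsBijSelfAdjoint S) : Y.K ≃ₗ[ℂ] LinearMap.range (embed hS) :=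
  LinearEquiv.ofInjective (embed hS) (embed_injective hS)

/-- The triple `(K₋, {·, ·}₋, 𝔱)` with `dom 𝔱 = K` (as a subspace of `K₋`) and `𝔱 = [·, ·]`,
where `K₋` is the dual of `K₊ = dom S` and `S = (J A) ^ (1/2)`. -/
def toFormTriple (hY : Y.IsJNonnegOperator) (hS : IsNonnegSqrt S (Y.opJA hJ)) : FormTriple.{u} where
  H := KMinus (hY.sqrt_bij hS)
  dom := LinearMap.range (embed (hY.sqrt_bij hS))
  form := (Y.form.comp (embedEquiv (hY.sqrt_bij hS)).symm.toLinearMap).compl₂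
    (embedEquiv (hY.sqrt_bij hS)).symm.toLinearMap

end Embedding

end OpTriple

/-- The triple `(dom 𝔱, 𝔱, A)` with `A` the range restriction of `T` to `dom 𝔱`. -/
def FormTriple.toOpTriple (X : FormTriple.{u}) (T : X.H →ₗ.[ℂ] X.H) : OpTriple.{u} where
  K := X.dom
  form := X.form
  A := rangeRestriction X.dom T

/-! ### The two classes and their quotients by isometric identification -/

/-- Triples `(H, (·, ·), 𝔱)` with a closed symmetric form with gap point `0`. -/
abbrev ClosedForm : Type (u + 1) := {X : FormTriple.{u} // X.IsClosedSymmGapZero}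

/-- Triples `(K, [·, ·], A)` with a J-non-negative, J-self-adjoint, boundedly invertible operator in
a Kreĭn space. -/
abbrev JNonnegOp : Type (u + 1) := {Y : OpTriple.{u} // Y.IsJNonnegOperator}

instance ClosedForm.setoid : Setoid ClosedForm.{u} where
  r X Y := X.1.Identified Y.1
  iseqv :=
    { refl := fun X => ⟨LinearIsometryEquiv.refl ℂ _, fun _ => Iff.rfl, by
        intro f g f' g' hf hg
        rw [show f' = f from Subtype.ext hf, show g' = g from Subtype.ext hg]⟩
      symm := by
        rintro X Y ⟨e, h1, h2⟩
        refine ⟨e.symm, fun y => ?_, fun f g f' g' hf hg => ?_⟩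
        · rw [h1, LinearIsometryEquiv.apply_symm_apply]
        · exact (h2 f' g' f g (by rw [hf, LinearIsometryEquiv.apply_symm_apply])
            (by rw [hg, LinearIsometryEquiv.apply_symm_apply])).symm
      trans := by
        rintro X Y Z ⟨e, h1, h2⟩ ⟨e', h1', h2'⟩
        refine ⟨e.trans e', fun x => (h1 x).trans (h1' _), fun f g f' g' hf hg => ?_⟩
        exact (h2 f g ⟨e f, (h1 _).1 f.2⟩ ⟨e g, (h1 _).1 g.2⟩ rfl rfl).trans
          (h2' _ _ _ _ hf hg) }

instance JNonnegOp.setoid : Setoid JNonnegOp.{u} where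
  r X Y := X.1.Identified Y.1
  iseqv :=
    { refl := fun X => ⟨LinearEquiv.refl ℂ _, fun _ _ => rfl, fun _ => Iff.rfl, by
        intro x x' hx
        rw [show x' = x from Subtype.ext hx]; rfl⟩
      symm := by
        rintro X Y ⟨e, h1, h2, h3⟩
        refine ⟨e.symm, fun x y => ?_, fun x => ?_, fun x x' hx => ?_⟩
        · rw [h1, LinearEquiv.apply_symm_apply, LinearEquiv.apply_symm_apply]
        · rw [h2, LinearEquiv.apply_symm_apply]
        · rw [h3 x' x (by rw [hx, LinearEquiv.apply_symm_apply]), LinearEquiv.symm_apply_apply]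
      trans := by
        rintro X Y Z ⟨e, h1, h2, h3⟩ ⟨e', h1', h2', h3'⟩
        refine ⟨e.trans e', fun x y => (h1 x y).trans (h1' _ _),
          fun x => (h2 x).trans (h2' _), fun x x' hx => ?_⟩
        have := h3' ⟨e x, (h2 _).1 x.2⟩ x' hx
        rw [this, h3 x _ rfl]; rfl }

end KreinForms

end

/-! Everything rests on reading operators through their graphs. If `0` is a gap point, then `T x =
h` means `𝔱[x, v] = (h, v)` for all `v ∈ dom 𝔱`. Each `h ∈ H` gives a functional that is continuous
in the Kreĭn topology, so Riesz representation makes `T` surjective. It is also symmetric, and a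
surjective symmetric operator is self-adjoint with bounded inverse.

The range restriction `A` satisfies `𝔱[x, v] = (A x, v)` on `dom 𝔱`. Hence it is surjective and
J-symmetric, and `𝔱[x, A x] = ‖A x‖²`, so the triple lies in the second class. Read backwards, `(y,
v) = 𝔱[A⁻¹ y, v]`: the form and `A` determine the inner product on the dense subspace `dom 𝔱`, and
so determine `H`. This is injectivity (`identified_of_toOpTriple`).

For surjectivity, `S² = J A` shows that the Riesz representative of `[·, v]` in `K₊` is `A⁻¹ v`, so
the inner product of `K₋` restricted to `K` is `[A⁻¹ ·, ·]` (`inner_embed_embed`). Since `K` is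
continuously and densely embedded in `K₋`, the form `[·, ·]` is closed there with gap point `0`.
J-self-adjointness then identifies its range restriction with `A`. -/

namespace KreinForms

/-! ### Surjective symmetric operators, their inverses and square roots -/

section UnboundedOperators

variable {E : Type u} [NormedAddCommGroup E] [InnerProductSpace ℂ E]

/-- Formal self-adjointness in terms of the graph. -/
theorem isFormalAdjoint_of_graph {T : E →ₗ.[ℂ] E}
    (h : ∀ x y x' y', (x, y) ∈ T.graph → (x', y') ∈ T.graph → inner ℂ y x' = inner ℂ x y') :
    T.IsFormalAdjoint T :=
  fun x y => h _ _ _ _ (T.mem_graph x) (T.mem_graph y)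

theorem inner_eq_of_mem_graph {T : E →ₗ.[ℂ] E} (hT : T.IsFormalAdjoint T) {x y x' y' : E}
    (h : (x, y) ∈ T.graph) (h' : (x', y') ∈ T.graph) : inner ℂ y x' = inner ℂ x y' := by
  obtain ⟨a, rfl, rfl⟩ := (LinearPMap.mem_graph_iff _).1 h
  obtain ⟨b, rfl, rfl⟩ := (LinearPMap.mem_graph_iff _).1 h'
  exact hT a b

variable [CompleteSpace E]

/-- A surjective formally self-adjoint operator is densely defined. -/
theorem dense_domain_of_surjective {T : E →ₗ.[ℂ] E} (hs : T.IsFormalAdjoint T)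
    (h : Function.Surjective T) : Dense (T.domain : Set E) := by
  rw [Submodule.dense_iff_topologicalClosure_eq_top, Submodule.topologicalClosure_eq_top_iff,
    Submodule.eq_bot_iff]
  intro y hy
  obtain ⟨x, rfl⟩ := h y
  -- With `y = T x` orthogonal to the domain and `T z = x`, one gets `‖x‖² = ⟨T z, x⟩ = ⟨z, y⟩ = 0`.
  have hx : (x : E) = 0 := by
    obtain ⟨z, hz⟩ := h (x : E)
    have h1 : inner ℂ (T z) (x : E) = 0 := by
      rw [hs]
      exact (Submodule.mem_orthogonal _ _).1 hy z z.2
    rwa [hz, inner_self_eq_zero] at h1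
  rw [show x = 0 from Subtype.ext hx, LinearPMap.map_zero]

/-- A surjective formally self-adjoint operator is self-adjoint. -/
theorem isSelfAdjoint_of_surjective {T : E →ₗ.[ℂ] E} (hs : T.IsFormalAdjoint T)
    (h : Function.Surjective T) : IsSelfAdjoint T := by
  have hd := dense_domain_of_surjective hs h
  rw [LinearPMap.isSelfAdjoint_def]
  have hle : T ≤ T.adjoint := LinearPMap.IsFormalAdjoint.le_adjoint hd hs
  refine (LinearPMap.eq_of_le_of_domain_eq hle (le_antisymm hle.1 fun y hy => ?_)).symm
  -- Solve `T x = T* y` in the domain of `T`. Then `y - x` is orthogonal to the range of `T`, which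
  -- is everything.
  obtain ⟨x, hx⟩ := h (T.adjoint ⟨y, hy⟩)
  have hyx : y - x = 0 := by
    obtain ⟨z, hz⟩ := h (y - x)
    have h1 := LinearPMap.adjoint_isFormalAdjoint hd ⟨y, hy⟩ z
    rw [← hx, hs x z] at h1
    have h2 : inner ℂ (y - x) (T z) = 0 := by rw [inner_sub_left, ← h1, sub_self]
    rwa [hz, inner_self_eq_zero] at h2
  rw [sub_eq_zero.1 hyx]
  exact x.2

theorem isFormalAdjoint_of_isSelfAdjoint {T : E →ₗ.[ℂ] E} (hT : IsSelfAdjoint T) :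
    T.IsFormalAdjoint T := by
  have h := LinearPMap.adjoint_isFormalAdjoint hT.dense_domain
  rwa [LinearPMap.isSelfAdjoint_def.1 hT] at h

/-- Self-adjoint operators are maximal among the formally self-adjoint ones. -/
theorem eq_of_le_of_isSelfAdjoint {S T : E →ₗ.[ℂ] E} (hS : IsSelfAdjoint S)
    (hT : T.IsFormalAdjoint T) (h : S ≤ T) : S = T := by
  refine le_antisymm h ?_
  -- Symmetry of an extension `T` of `S` gives `T ≤ S* = S`.
  have h1 : S.IsFormalAdjoint T := fun x y => by
    obtain ⟨x', e1, e2⟩ := LinearPMap.exists_of_le h x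
    rw [e1, e2]
    exact hT x' y
  have h2 := LinearPMap.IsFormalAdjoint.le_adjoint hS.dense_domain h1
  rwa [LinearPMap.isSelfAdjoint_def.1 hS] at h2

/-- Membership in the graph of a self-adjoint operator can be tested against the graph. -/
theorem mem_graph_of_isSelfAdjoint {T : E →ₗ.[ℂ] E} (hT : IsSelfAdjoint T) {x y : E}
    (h : ∀ z : T.domain, inner ℂ y (z : E) = inner ℂ x (T z)) : (x, y) ∈ T.graph := by
  have hx : x ∈ T.adjoint.domain := LinearPMap.mem_adjoint_domain_of_exists x ⟨y, h⟩
  have e := LinearPMap.adjoint_apply_eq hT.dense_domain ⟨x, hx⟩ h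
  have hm : (x, y) ∈ T.adjoint.graph := by
    rw [← e]
    exact T.adjoint.mem_graph ⟨x, hx⟩
  rwa [LinearPMap.isSelfAdjoint_def.1 hT] at hm

/-- A surjective formally self-adjoint operator has a bounded symmetric inverse. -/
theorem exists_bounded_inverse {T : E →ₗ.[ℂ] E} (hs : T.IsFormalAdjoint T)
    (h : Function.Surjective T) :
    ∃ R : E →L[ℂ] E, (R : E →ₗ[ℂ] E).IsSymmetric ∧ ∀ x y, (x, y) ∈ T.graph ↔ x = R y := by
  have hd := dense_domain_of_surjective hs h
  have hinj : Function.Injective T := by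
    intro a b hab
    have h0 : T (a - b) = 0 := by rw [LinearPMap.map_sub, hab, sub_self]
    obtain ⟨z, hz⟩ := h ((a - b : T.domain) : E)
    have h1 := hs (a - b) z
    rw [h0, inner_zero_left, hz] at h1
    exact sub_eq_zero.1 (Subtype.ext (inner_self_eq_zero.1 h1.symm))
  let e := LinearEquiv.ofBijective T.toFun ⟨hinj, h⟩
  have he : ∀ y, T (e.symm y) = y := fun y => e.apply_symm_apply y
  let R : E →ₗ[ℂ] E := T.domain.subtype ∘ₗ e.symm.toLinearMap
  have hR : R.IsSymmetric := fun x y => by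
    change inner ℂ ((e.symm x : T.domain) : E) y = inner ℂ x ((e.symm y : T.domain) : E)
    conv_lhs => rw [← he y]
    conv_rhs => rw [← he x]
    exact (hs _ _).symm
  -- Boundedness is the Hellinger–Toeplitz theorem for the everywhere defined symmetric `R`.
  refine ⟨⟨R, hR.continuous⟩, hR, fun x y => ?_⟩
  rw [LinearPMap.mem_graph_iff]
  constructor
  · rintro ⟨z, hz, hy⟩
    rw [← show (z : E) = x from hz, ← show T z = y from hy]
    exact congrArg Subtype.val (e.symm_apply_apply z).symm
  · rintro rfl
    exact ⟨e.symm y, rfl, he y⟩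

/-- An injective bounded symmetric operator is the inverse of a surjective formally self-adjoint
operator. -/
theorem exists_inverse_of_injective {R : E →L[ℂ] E} (hR : (R : E →ₗ[ℂ] E).IsSymmetric)
    (hinj : Function.Injective R) :
    ∃ T : E →ₗ.[ℂ] E, IsSelfAdjoint T ∧ ∀ x y, (x, y) ∈ T.graph ↔ x = R y := by
  let g : Submodule ℂ (E × E) :=
    LinearMap.range ((R : E →ₗ[ℂ] E).prod LinearMap.id)
  have hg : ∀ x y, (x, y) ∈ g ↔ x = R y := by
    intro x y
    constructor
    · rintro ⟨z, hz⟩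
      obtain ⟨rfl, rfl⟩ := Prod.ext_iff.1 hz
      rfl
    · rintro rfl
      exact ⟨y, rfl⟩
  -- The flipped graph of `R` is single-valued because `R` is injective.
  have hgr : g.toLinearPMap.graph = g := Submodule.toLinearPMap_graph_eq g (by
    rintro ⟨x, y⟩ hx (h0 : x = 0)
    rw [hg, h0] at hx
    exact hinj (hx.symm.trans (map_zero R).symm))
  refine ⟨g.toLinearPMap, isSelfAdjoint_of_surjective (isFormalAdjoint_of_graph ?_) ?_, ?_⟩
  · intro x y x' y' h h'
    rw [hgr, hg] at h h'
    rw [h, h']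
    exact (hR y y').symm
  · intro y
    have := (hg (R y) y).2 rfl
    rw [← hgr, LinearPMap.mem_graph_iff] at this
    obtain ⟨z, -, hz⟩ := this
    exact ⟨z, hz⟩
  · intro x y
    rw [hgr, hg]

-- Substituting `x = R y`, `T x = y` turns `⟨R y, y⟩` into `⟨x, T x⟩`.
omit [CompleteSpace E] in
theorem isPositive_of_graph {T : E →ₗ.[ℂ] E} (hn : IsNonnegOp T) {R : E →L[ℂ] E}
    (hR : (R : E →ₗ[ℂ] E).IsSymmetric) (h : ∀ x y, (x, y) ∈ T.graph ↔ x = R y) :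
    0 ≤ R := by
  rw [ContinuousLinearMap.nonneg_iff_isPositive]
  refine ⟨hR, fun y => ?_⟩
  obtain ⟨x, hx, hy⟩ := (LinearPMap.mem_graph_iff T).1 ((h (R y) y).2 rfl)
  rw [ContinuousLinearMap.reApplyInnerSelf_apply]
  have := hn x
  rwa [show (x : E) = R y from hx, show T x = y from hy] at this

/-- A non-negative self-adjoint bijective operator has a unique non-negative square root. -/
theorem existsUnique_nonnegSqrt {T : E →ₗ.[ℂ] E} (hT : IsSelfAdjoint T) (hn : IsNonnegOp T)
    (hb : Function.Bijective T) :
    ∃ S, IsNonnegSqrt S T ∧ ∀ S', IsNonnegSqrt S' T → S' = S := by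
  obtain ⟨R, hRs, hR⟩ := exists_bounded_inverse (isFormalAdjoint_of_isSelfAdjoint hT) hb.2
  have hR0 := isPositive_of_graph hn hRs hR
  have hinj : Function.Injective R := by
    intro a b hab
    have h1 := (hR (R a) a).2 rfl
    have h2 := (hR (R a) b).2 hab
    exact T.mem_graph_snd_inj h1 h2 rfl
  -- The root is taken on the bounded side: `R = T⁻¹` is positive, and `S` will be the inverse of
  -- its square root `Q`.
  set Q := CFC.sqrt R with hQ
  have hQQ : ∀ y, Q (Q y) = R y := fun y =>
    congrArg (fun U : E →L[ℂ] E => U y) (CFC.sqrt_mul_sqrt_self R hR0)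
  have hQp : Q.IsPositive := (ContinuousLinearMap.nonneg_iff_isPositive Q).1 (CFC.sqrt_nonneg R)
  have hQinj : Function.Injective Q := fun a b hab =>
    hinj (by rw [← hQQ, ← hQQ, hab])
  obtain ⟨S, hS, hSg⟩ := exists_inverse_of_injective hQp.isSymmetric hQinj
  refine ⟨S, ⟨hS, fun x => ?_, fun x y => ?_⟩, fun S' hS' => ?_⟩
  · have hx := (hSg _ _).1 (S.mem_graph x)
    conv => enter [2, 1, 2]; rw [hx]
    exact hQp.2 (S x)
  · rw [hR]
    constructor
    · rintro rfl
      exact ⟨Q y, (hSg _ _).2 (hQQ y).symm, (hSg _ _).2 rfl⟩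
    · rintro ⟨z, h1, h2⟩
      rw [(hSg _ _).1 h1, (hSg _ _).1 h2, hQQ]
  -- The inverse of any other root `S'` of `T` is a positive bounded root of `R`, hence equals `Q`.
  · have hb' := (hS'.isBijSelfAdjoint hb).bij
    obtain ⟨Q', hQs, hQ'⟩ :=
      exists_bounded_inverse (isFormalAdjoint_of_isSelfAdjoint hS'.selfAdjoint) hb'.2
    have hsq : Q' * Q' = R := by
      ext y
      obtain ⟨z, h1, h2⟩ := (hS'.sq _ _).1 ((hR (R y) y).2 rfl)
      rw [hQ'] at h1 h2
      rw [h1, h2]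
      rfl
    have hQQ' : Q = Q' := CFC.sqrt_unique hsq (isPositive_of_graph hS'.nonneg hQs hQ')
    refine LinearPMap.eq_of_eq_graph (Submodule.ext ?_)
    rintro ⟨x, y⟩
    rw [hQ', hSg, hQQ']

/-- A linear map between Hilbert spaces with an everywhere defined formal adjoint is continuous. -/
theorem continuous_of_exists_formal_adjoint {F : Type*} [NormedAddCommGroup F]
    [InnerProductSpace ℂ F] [CompleteSpace F] (U : E →ₗ[ℂ] F)
    (h : ∀ y, ∃ w, ∀ x, inner ℂ y (U x) = inner ℂ w x) : Continuous U := by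
  refine U.continuous_of_seq_closed_graph fun u x y hu hTu => ?_
  refine ext_inner_left ℂ fun z => ?_
  obtain ⟨w, hw⟩ := h z
  refine tendsto_nhds_unique (tendsto_const_nhds.inner hTu) ?_
  simp_rw [Function.comp_apply, hw]
  exact tendsto_const_nhds.inner hu

end UnboundedOperators

/-! ### Fundamental symmetries, nondegeneracy and Riesz representation -/

section Krein

variable {K : Type u} [AddCommGroup K] [Module ℂ K] {B : SForm K}

theorem IsKreinForm.exists_fundamentalSymmetry (h : IsKreinForm B) :
    ∃ J, IsFundamentalSymmetry B J := by
  obtain ⟨P, N, hd⟩ := h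
  refine ⟨P.subtype ∘ₗ P.projectionOnto N hd.isCompl -
    N.subtype ∘ₗ N.projectionOnto P hd.isCompl.symm, P, N, hd, fun p hp => ?_, fun n hn => ?_⟩
  · have h1 := Submodule.projectionOnto_apply_left hd.isCompl ⟨p, hp⟩
    have h2 := Submodule.projectionOnto_apply_right hd.isCompl.symm ⟨p, hp⟩
    simp only [LinearMap.sub_apply, LinearMap.comp_apply] at h1 h2 ⊢
    rw [h1, h2]
    simp
  · have h1 := Submodule.projectionOnto_apply_left hd.isCompl.symm ⟨n, hn⟩
    have h2 := Submodule.projectionOnto_apply_right hd.isCompl ⟨n, hn⟩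
    simp only [LinearMap.sub_apply, LinearMap.comp_apply] at h1 h2 ⊢
    rw [h1, h2]
    simp

namespace IsFundamentalSymmetry

variable {J : K →ₗ[ℂ] K}

theorem symm (hJ : IsFundamentalSymmetry B J) : IsSymmForm B := by
  obtain ⟨P, N, hd, -⟩ := hJ
  exact hd.symm

theorem apply_eq_inner (hJ : IsFundamentalSymmetry B J) (x y : K) :
    B x y = inner ℂ (JSpace.of hJ (J x)) (JSpace.of hJ y) := by
  change B x y = B (J (J x)) y
  rw [hJ.involutive]

theorem apply_left_eq_inner (hJ : IsFundamentalSymmetry B J) (x y : K) :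
    B (J x) y = inner ℂ (JSpace.of hJ x) (JSpace.of hJ y) := rfl

theorem apply_left_eq_apply_right (hJ : IsFundamentalSymmetry B J) (x y : K) :
    B (J x) y = B x (J y) := by
  have h1 : conj (B (J y) x) = B (J x) y := hJ.isPosDefForm.symm y x
  rw [← h1, hJ.symm]

/-- Nondegeneracy: testing with `y = J x` gives `{J x, J x} = 0`. -/
theorem eq_zero_of_forall (hJ : IsFundamentalSymmetry B J) {x : K} (h : ∀ y, B x y = 0) :
    x = 0 := by
  have h1 : J x = 0 := hJ.isPosDefForm.definite _ (by
    change B (J (J x)) (J x) = 0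
    rw [hJ.involutive, h])
  rw [← hJ.involutive x, h1, map_zero]

/-- Through Hellinger–Toeplitz, this makes `J` bounded. -/
theorem isSymmetric (hJ : IsFundamentalSymmetry B J) :
    (show JSpace hJ →ₗ[ℂ] JSpace hJ from J).IsSymmetric := by
  intro x y
  exact hJ.apply_left_eq_apply_right (J ((JSpace.of hJ).symm x)) ((JSpace.of hJ).symm y)

/-- Riesz representation for the indefinite form: apply `J` to the Riesz vector of the Hilbert space
`(K, {·, ·})`. -/
theorem exists_eq_of_continuous (hJ : IsFundamentalSymmetry B J) (φ : K →ₗ[ℂ] ℂ)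
    (hφ : Continuous fun x : JSpace hJ => φ ((JSpace.of hJ).symm x)) : ∃ x, ∀ y, B x y = φ y := by
  let ψ : StrongDual ℂ (JSpace hJ) := ⟨φ ∘ₗ (JSpace.of hJ).symm.toLinearMap, hφ⟩
  refine ⟨J ((JSpace.of hJ).symm ((InnerProductSpace.toDual ℂ _).symm ψ)), fun y => ?_⟩
  rw [hJ.apply_left_eq_inner, LinearEquiv.apply_symm_apply]
  exact InnerProductSpace.toDual_symm_apply

end IsFundamentalSymmetry

end Krein

/-! ### Transport of Kreĭn structures along linear bijections -/

section Transport

variable {V W : Type u} [AddCommGroup V] [Module ℂ V] [AddCommGroup W] [Module ℂ W]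
  {B : SForm V} {C : SForm W}

theorem IsPosDefForm.of_equiv (h : IsPosDefForm B) (e : V ≃ₗ[ℂ] W)
    (he : ∀ x y, B x y = C (e x) (e y)) : IsPosDefForm C := by
  have he' : ∀ x y, C x y = B (e.symm x) (e.symm y) := fun x y => by simp [he]
  refine ⟨fun x y => ?_, fun x => ?_, fun x hx => ?_⟩
  · rw [he', he', h.symm]
  · rw [he']
    exact h.nonneg _
  · rw [he'] at hx
    exact (LinearEquiv.map_eq_zero_iff _).1 (h.definite _ hx)

theorem IsHilbertForm.of_equiv (h : IsHilbertForm B) (e : V ≃ₗ[ℂ] W)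
    (he : ∀ x y, B x y = C (e x) (e y)) : IsHilbertForm C := by
  obtain ⟨h, hc⟩ := h
  have h' := h.of_equiv e he
  refine ⟨h', ?_⟩
  let f : FormSpace h ≃ₗᵢ[ℂ] FormSpace h' :=
    ((FormSpace.of h).symm.trans (e.trans (FormSpace.of h'))).isometryOfInner
      fun x y => (he x y).symm
  exact f.isometry.isUniformInducing.completeSpace_congr f.surjective |>.1 hc

theorem IsFundamentalDecomposition.of_equiv {P N : Submodule ℂ V}
    (h : IsFundamentalDecomposition B P N) (e : V ≃ₗ[ℂ] W)
    (he : ∀ x y, B x y = C (e x) (e y)) :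
    IsFundamentalDecomposition C (P.map e.toLinearMap) (N.map e.toLinearMap) where
  symm x y := by
    obtain ⟨a, rfl⟩ := e.surjective x
    obtain ⟨b, rfl⟩ := e.surjective y
    rw [← he, ← he, h.symm]
  isCompl := h.isCompl.map (Submodule.orderIsoMapComap e)
  orthogonal := by
    rintro _ ⟨p, hp, rfl⟩ _ ⟨n, hn, rfl⟩
    exact (he p n).symm.trans (h.orthogonal p hp n hn)
  hilbert_pos := h.hilbert_pos.of_equiv (e.submoduleMap P) fun x y => he x y
  hilbert_neg := h.hilbert_neg.of_equiv (e.submoduleMap N) fun x y => congrArg Neg.neg (he x y)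

theorem IsKreinForm.of_equiv (h : IsKreinForm B) (e : V ≃ₗ[ℂ] W)
    (he : ∀ x y, B x y = C (e x) (e y)) : IsKreinForm C := by
  obtain ⟨P, N, hd⟩ := h
  exact ⟨_, _, hd.of_equiv e he⟩

theorem IsFundamentalSymmetry.of_equiv {J : V →ₗ[ℂ] V} (h : IsFundamentalSymmetry B J)
    (e : V ≃ₗ[ℂ] W) (he : ∀ x y, B x y = C (e x) (e y)) :
    IsFundamentalSymmetry C (e.toLinearMap ∘ₗ J ∘ₗ e.symm.toLinearMap) := by
  obtain ⟨P, N, hd, hP, hN⟩ := h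
  refine ⟨_, _, hd.of_equiv e he, ?_, ?_⟩
  · rintro _ ⟨p, hp, rfl⟩
    simp [hP p hp]
  · rintro _ ⟨n, hn, rfl⟩
    simp [hN n hn]

end Transport

/-! ### Representing operators and their range restrictions -/

theorem mem_graph_rangeRestriction {H : Type u} [AddCommGroup H] [Module ℂ H] (D : Submodule ℂ H)
    (T : H →ₗ.[ℂ] H) (x y : D) :
    (x, y) ∈ (rangeRestriction D T).graph ↔ ((x : H), (y : H)) ∈ T.graph := by
  rw [LinearPMap.mem_graph_iff, LinearPMap.mem_graph_iff]
  constructor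
  · rintro ⟨z, hz, hy⟩
    obtain ⟨h, -⟩ := z.2
    exact ⟨⟨((z : D) : H), h⟩, congrArg Subtype.val hz, congrArg Subtype.val hy⟩
  · rintro ⟨z, hz, hy⟩
    obtain ⟨z, h⟩ := z
    obtain rfl : z = x := hz
    exact ⟨⟨x, h, by rw [show T ⟨x, h⟩ = y from hy]; exact y.2⟩, rfl, Subtype.ext hy⟩

namespace FormTriple

variable {X : FormTriple.{u}}

theorem shift_zero (X : FormTriple.{u}) : X.shift 0 = X.form := by
  simp [shift]

theorem isGapPoint_zero_iff : X.IsGapPoint 0 ↔ IsKreinForm X.form ∧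
    ∀ (J : X.dom →ₗ[ℂ] X.dom) (hJ : IsFundamentalSymmetry X.form J),
      Continuous (fun x : JSpace hJ => (((JSpace.of hJ).symm x : X.dom) : X.H)) := by
  -- The Hilbert space `JSpace hJ` depends on the form, so the form is made a variable before the
  -- equality is substituted.
  have h : ∀ B : SForm X.dom, B = X.form → ((IsKreinForm B ∧
      ∀ (J : X.dom →ₗ[ℂ] X.dom) (hJ : IsFundamentalSymmetry B J),
        Continuous (fun x : JSpace hJ => (((JSpace.of hJ).symm x : X.dom) : X.H))) ↔
      IsKreinForm X.form ∧ ∀ (J : X.dom →ₗ[ℂ] X.dom) (hJ : IsFundamentalSymmetry X.form J),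
        Continuous (fun x : JSpace hJ => (((JSpace.of hJ).symm x : X.dom) : X.H))) := by
    rintro _ rfl
    rfl
  exact h _ X.shift_zero

namespace IsClosedSymmGapZero

theorem krein (hX : X.IsClosedSymmGapZero) : IsKreinForm X.form :=
  (isGapPoint_zero_iff.1 hX.gap).1

theorem eq_zero_of_inner (hX : X.IsClosedSymmGapZero) {h : X.H}
    (h0 : ∀ v : X.dom, inner ℂ h (v : X.H) = 0) : h = 0 :=
  hX.dense.eq_zero_of_inner_left ℂ fun v hv => h0 ⟨v, hv⟩

/-- Every bounded functional on `H` is represented by the form. -/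
theorem exists_form_eq_inner (hX : X.IsClosedSymmGapZero) (h : X.H) :
    ∃ x : X.dom, ∀ v : X.dom, X.form x v = inner ℂ h (v : X.H) := by
  obtain ⟨J, hJ⟩ := hX.krein.exists_fundamentalSymmetry
  exact hJ.exists_eq_of_continuous ((innerSL ℂ h).toLinearMap ∘ₗ X.dom.subtype)
    ((innerSL ℂ h).continuous.comp ((isGapPoint_zero_iff.1 hX.gap).2 J hJ))

/-- The graph of a representing operator consists of the pairs `(x, h)` with `𝔱[x, v] = (h, v)`. -/
theorem mem_graph_iff (hX : X.IsClosedSymmGapZero) {T : X.H →ₗ.[ℂ] X.H}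
    (hT : X.IsRepresentingOperator T) (x : X.dom) (h : X.H) :
    ((x : X.H), h) ∈ T.graph ↔ ∀ v : X.dom, X.form x v = inner ℂ h (v : X.H) := by
  have key : ∀ (y : T.domain) (v : X.dom),
      X.form ⟨y, hT.domain_le y.2⟩ v = inner ℂ (T y) (v : X.H) := fun y v => by
    rw [← hX.symm, hT.represents, inner_conj_symm]
  constructor
  · intro hm v
    obtain ⟨y, hy, rfl⟩ := (LinearPMap.mem_graph_iff T).1 hm
    rw [← key]
    exact congrArg (fun z => X.form z v) (Subtype.ext hy.symm)
  · intro hx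
    refine mem_graph_of_isSelfAdjoint hT.selfAdjoint fun z => ?_
    rw [← hT.represents z x, hx ⟨z, hT.domain_le z.2⟩]

/-- The relation `𝔱[x, ·] = (h, ·)` between `x` and `h` is single-valued since `dom 𝔱` is dense, and
onto by `exists_form_eq_inner`. The symmetry of `𝔱` then makes it a self-adjoint operator. -/
theorem exists_representingOperator (hX : X.IsClosedSymmGapZero) :
    ∃ T : X.H →ₗ.[ℂ] X.H, X.IsRepresentingOperator T := by
  let g : Submodule ℂ (X.H × X.H) :=
    { carrier := {p | ∃ x : X.dom, (x : X.H) = p.1 ∧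
        ∀ v : X.dom, X.form x v = inner ℂ p.2 (v : X.H)}
      zero_mem' := ⟨0, rfl, fun v => by simp⟩
      add_mem' := by
        rintro p q ⟨x, hx, hp⟩ ⟨y, hy, hq⟩
        exact ⟨x + y, by simp [hx, hy], fun v => by
          rw [map_add, LinearMap.add_apply, hp, hq, Prod.snd_add, inner_add_left]⟩
      smul_mem' := by
        rintro c p ⟨x, hx, hp⟩
        exact ⟨c • x, by simp [hx], fun v => by
          rw [LinearMap.map_smulₛₗ, LinearMap.smul_apply, hp, Prod.smul_snd, inner_smul_left]
          rfl⟩ }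
  have hg : ∀ p, p ∈ g ↔ ∃ x : X.dom, (x : X.H) = p.1 ∧
      ∀ v : X.dom, X.form x v = inner ℂ p.2 (v : X.H) := fun p => Iff.rfl
  have hgr : g.toLinearPMap.graph = g := Submodule.toLinearPMap_graph_eq g (by
    rintro ⟨x, y⟩ ⟨x', hx', hy⟩ (rfl : x = 0)
    obtain rfl : x' = 0 := Subtype.ext hx'
    exact hX.eq_zero_of_inner fun v => by rw [← hy, map_zero, LinearMap.zero_apply])
  have hsurj : Function.Surjective g.toLinearPMap := fun h => by
    obtain ⟨x, hx⟩ := hX.exists_form_eq_inner h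
    have hm : ((x : X.H), h) ∈ g.toLinearPMap.graph := by
      rw [hgr]
      exact ⟨x, rfl, hx⟩
    obtain ⟨z, -, hz⟩ := (LinearPMap.mem_graph_iff _).1 hm
    exact ⟨z, hz⟩
  have hrep : ∀ x : g.toLinearPMap.domain, ∃ x' : X.dom, (x' : X.H) = x ∧
      ∀ v : X.dom, X.form x' v = inner ℂ (g.toLinearPMap x) (v : X.H) := fun x => by
    have := g.toLinearPMap.mem_graph x
    rwa [hgr] at this
  refine ⟨g.toLinearPMap, isSelfAdjoint_of_surjective (fun x y => ?_) hsurj, fun x hx => ?_,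
    fun x v => ?_⟩
  · obtain ⟨x', hx, hx'⟩ := hrep x
    obtain ⟨y', hy, hy'⟩ := hrep y
    rw [← hx, ← hy, ← hx', ← hX.symm, hy', inner_conj_symm]
  · obtain ⟨x', hx', -⟩ := hrep ⟨x, hx⟩
    rw [← show (x' : X.H) = x from hx']
    exact x'.2
  · obtain ⟨x', hx, hx'⟩ := hrep x
    rw [← hX.symm, ← inner_conj_symm, ← hx']
    exact congrArg (fun z => conj (X.form z v)) (Subtype.ext hx.symm)

/-- Both graphs satisfy the same description `mem_graph_iff`. One inclusion suffices, by maximality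
of self-adjoint operators. -/
theorem representingOperator_unique (hX : X.IsClosedSymmGapZero) {S T : X.H →ₗ.[ℂ] X.H}
    (hS : X.IsRepresentingOperator S) (hT : X.IsRepresentingOperator T) : S = T := by
  refine eq_of_le_of_isSelfAdjoint hS.selfAdjoint
    (isFormalAdjoint_of_isSelfAdjoint hT.selfAdjoint) (LinearPMap.le_of_le_graph ?_)
  rintro ⟨x, h⟩ hx
  have hd : x ∈ X.dom := hS.domain_le (LinearPMap.mem_domain_of_mem_graph hx)
  exact (hX.mem_graph_iff hT ⟨x, hd⟩ h).2 ((hX.mem_graph_iff hS ⟨x, hd⟩ h).1 hx)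

/-- The graph of the range restriction of a representing operator. -/
theorem mem_graph_toOpTriple (hX : X.IsClosedSymmGapZero) {T : X.H →ₗ.[ℂ] X.H}
    (hT : X.IsRepresentingOperator T) (x y : X.dom) :
    (x, y) ∈ (X.toOpTriple T).A.graph ↔ ∀ v : X.dom, X.form x v = inner ℂ (y : X.H) (v : X.H) :=
  (mem_graph_rangeRestriction X.dom T x y).trans (hX.mem_graph_iff hT x y)

end IsClosedSymmGapZero

end FormTriple

/-! ### A criterion for membership in the class of J-non-negative operators -/

namespace OpTriple

variable {Y : OpTriple.{u}} {J : Y.K →ₗ[ℂ] Y.K}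

theorem mem_graph_opJA (hJ : IsFundamentalSymmetry Y.form J) (x y : Y.K) :
    (JSpace.of hJ x, JSpace.of hJ y) ∈ (Y.opJA hJ).graph ↔ (x, J y) ∈ Y.A.graph := by
  rw [LinearPMap.mem_graph_iff, LinearPMap.mem_graph_iff]
  constructor
  · rintro ⟨z, hz, hy⟩
    refine ⟨z, hz, ?_⟩
    rw [← hJ.involutive (Y.A z)]
    exact congrArg J hy
  · rintro ⟨z, hz, hy⟩
    exact ⟨z, hz, (congrArg J hy).trans (hJ.involutive y)⟩

/-- A surjective operator that is symmetric and non-negative with respect to the form of a Kreĭn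
space is J-self-adjoint, J-non-negative and boundedly invertible. -/
theorem isJNonnegOperator_of_surjective (hK : IsKreinForm Y.form)
    (hsymm : ∀ x y x' y', (x, y) ∈ Y.A.graph → (x', y') ∈ Y.A.graph →
      Y.form y x' = Y.form x y')
    (hnn : ∀ x y, (x, y) ∈ Y.A.graph → 0 ≤ (Y.form x y).re)
    (hsurj : ∀ y, ∃ x, (x, y) ∈ Y.A.graph) : Y.IsJNonnegOperator := by
  have hfa : ∀ (J : Y.K →ₗ[ℂ] Y.K) (hJ : IsFundamentalSymmetry Y.form J),
      (Y.opJA hJ).IsFormalAdjoint (Y.opJA hJ) := fun J hJ => by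
    refine isFormalAdjoint_of_graph fun (x y x' y' : Y.K) h h' => ?_
    have h1 := hsymm _ _ _ _ ((mem_graph_opJA hJ x y).1 h) ((mem_graph_opJA hJ x' y').1 h')
    rwa [← hJ.apply_left_eq_apply_right] at h1
  have hs : ∀ (J : Y.K →ₗ[ℂ] Y.K) (hJ : IsFundamentalSymmetry Y.form J),
      Function.Surjective (Y.opJA hJ) := fun J hJ (y : Y.K) => by
    obtain ⟨x, hx⟩ := hsurj (J y)
    obtain ⟨z, -, hz⟩ := (LinearPMap.mem_graph_iff _).1 ((mem_graph_opJA hJ x y).2 hx)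
    exact ⟨z, hz⟩
  refine ⟨hK, fun J hJ => isSelfAdjoint_of_surjective (hfa J hJ) (hs J hJ), fun J hJ x => ?_,
    fun J hJ => ?_⟩
  · have h1 : ∀ x y, (JSpace.of hJ x, JSpace.of hJ y) ∈ (Y.opJA hJ).graph →
        0 ≤ (Y.form (J x) y).re := fun x y h => by
      rw [hJ.apply_left_eq_apply_right]
      exact hnn _ _ ((mem_graph_opJA hJ x y).1 h)
    exact h1 _ _ ((Y.opJA hJ).mem_graph x)
  · obtain ⟨R, -, hR⟩ := exists_bounded_inverse (hfa J hJ) (hs J hJ)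
    -- The bounded inverse is `A⁻¹ = (J A)⁻¹ J`, that is `R ∘ U` with `U = J`.
    let U : JSpace hJ →L[ℂ] JSpace hJ := ⟨_, hJ.isSymmetric.continuous⟩
    have hU : ∀ y : Y.K, U (JSpace.of hJ y) = JSpace.of hJ (J y) := fun y => rfl
    have hRU : ∀ x y : Y.K, (x, y) ∈ Y.A.graph ↔
        JSpace.of hJ x = (R ∘L U) (JSpace.of hJ y) := fun x y => by
      rw [ContinuousLinearMap.comp_apply, hU, ← hR, mem_graph_opJA, hJ.involutive]
    refine ⟨R ∘L U, fun x => ((hRU _ _).1 (Y.A.mem_graph x)).symm, fun y => ?_⟩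
    have hm := (hRU ((JSpace.of hJ).symm ((R ∘L U) y)) ((JSpace.of hJ).symm y)).2 (by
      rw [LinearEquiv.apply_symm_apply, LinearEquiv.apply_symm_apply])
    obtain ⟨⟨z, hz⟩, e, hy⟩ := (LinearPMap.mem_graph_iff _).1 hm
    obtain rfl : z = _ := e
    exact ⟨hz, hy⟩

/-- A linear bijection which preserves the forms and the graphs is an identification. -/
theorem Identified.of_graph {Z : OpTriple.{u}} (e : Y.K ≃ₗ[ℂ] Z.K)
    (h : ∀ x y, Y.form x y = Z.form (e x) (e y))
    (hg : ∀ x y, (x, y) ∈ Y.A.graph ↔ (e x, e y) ∈ Z.A.graph) : Y.Identified Z := by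
  refine ⟨e, h, fun x => ?_, fun x x' hx => ?_⟩
  · rw [LinearPMap.mem_domain_iff, LinearPMap.mem_domain_iff]
    exact ⟨fun ⟨y, hy⟩ => ⟨e y, (hg _ _).1 hy⟩,
      fun ⟨y, hy⟩ => ⟨e.symm y, (hg _ _).2 (by rwa [e.apply_symm_apply])⟩⟩
  · have h1 := (hg _ _).1 (Y.A.mem_graph x)
    have h2 := Z.A.mem_graph x'
    rw [hx] at h2
    exact Z.A.mem_graph_snd_inj h2 h1 rfl

end OpTriple

/-! ### The map on triples: well-definedness and injectivity -/

namespace FormTriple.IsClosedSymmGapZero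

variable {X : FormTriple.{u}}

/-- For `y = A x` and `y' = A x'`, both `𝔱[y, x']` and `𝔱[x, y']` equal the inner product `(y, y')`,
and `𝔱[x, A x] = ‖A x‖²`. -/
theorem isJNonnegOperator (hX : X.IsClosedSymmGapZero) {T : X.H →ₗ.[ℂ] X.H}
    (hT : X.IsRepresentingOperator T) : (X.toOpTriple T).IsJNonnegOperator := by
  refine OpTriple.isJNonnegOperator_of_surjective hX.krein
    (fun (x y x' y' : X.dom) h h' => ?_) (fun (x y : X.dom) h => ?_) fun (y : X.dom) => ?_
  · have h1 := (hX.mem_graph_toOpTriple hT x y).1 h y'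
    have h2 := (hX.mem_graph_toOpTriple hT x' y').1 h' y
    change X.form y x' = X.form x y'
    rw [← hX.symm, h1, h2, inner_conj_symm]
  · have h1 := (hX.mem_graph_toOpTriple hT x y).1 h y
    change 0 ≤ (X.form x y).re
    rw [h1]
    exact inner_self_nonneg (𝕜 := ℂ)
  · obtain ⟨x, hx⟩ := hX.exists_form_eq_inner (y : X.H)
    exact ⟨x, (hX.mem_graph_toOpTriple hT x y).2 hx⟩

theorem identified_toOpTriple {X' : FormTriple.{u}} (hX : X.IsClosedSymmGapZero)
    (hX' : X'.IsClosedSymmGapZero) {T : X.H →ₗ.[ℂ] X.H} (hT : X.IsRepresentingOperator T)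
    {T' : X'.H →ₗ.[ℂ] X'.H} (hT' : X'.IsRepresentingOperator T') (h : X.Identified X') :
    (X.toOpTriple T).Identified (X'.toOpTriple T') := by
  obtain ⟨e, h1, h2⟩ := h
  let ψ : X.dom ≃ₗ[ℂ] X'.dom := e.toLinearEquiv.ofSubmodules _ _ (by
    ext y
    constructor
    · rintro ⟨x, hx, rfl⟩
      exact (h1 x).1 hx
    · intro hy
      exact ⟨e.symm y, (h1 _).2 (by rwa [e.apply_symm_apply]), e.apply_symm_apply y⟩)
  have hψ : ∀ x, ((ψ x : X'.dom) : X'.H) = e x := fun x => rfl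
  have hf : ∀ x y, X.form x y = X'.form (ψ x) (ψ y) := fun x y => h2 x y _ _ (hψ x) (hψ y)
  refine OpTriple.Identified.of_graph (Y := X.toOpTriple T) (Z := X'.toOpTriple T') ψ hf
    fun (x y : X.dom) => ?_
  refine (hX.mem_graph_toOpTriple hT x y).trans
    (Iff.trans ?_ (hX'.mem_graph_toOpTriple hT' (ψ x) (ψ y)).symm)
  rw [ψ.toEquiv.forall_congr_left]
  refine forall_congr' fun v => ?_
  obtain ⟨v, rfl⟩ := ψ.surjective v
  have : ψ.toEquiv.symm (ψ v) = v := ψ.symm_apply_apply v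
  rw [this, hf, hψ, hψ, e.inner_map_map]

/-- Since `(y, v) = 𝔱[A⁻¹ y, v]`, a bijection respecting form and operator is isometric for the
ambient inner products. Density of both domains extends it to a unitary map. -/
theorem identified_of_toOpTriple {X' : FormTriple.{u}} (hX : X.IsClosedSymmGapZero)
    (hX' : X'.IsClosedSymmGapZero) {T : X.H →ₗ.[ℂ] X.H} (hT : X.IsRepresentingOperator T)
    {T' : X'.H →ₗ.[ℂ] X'.H} (hT' : X'.IsRepresentingOperator T')
    (h : (X.toOpTriple T).Identified (X'.toOpTriple T')) : X.Identified X' := by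
  obtain ⟨e, h1, h2, h3⟩ := h
  let ψ : X.dom ≃ₗ[ℂ] X'.dom := e
  have hf : ∀ x y : X.dom, X.form x y = X'.form (ψ x) (ψ y) := h1
  have hinner : ∀ y v : X.dom, inner ℂ (y : X.H) (v : X.H) = inner ℂ (ψ y : X'.H) (ψ v : X'.H) := by
    intro y v
    obtain ⟨w, hw⟩ := hX.exists_form_eq_inner (y : X.H)
    have hm := (hX.mem_graph_toOpTriple hT w y).2 hw
    have hm' := (X'.toOpTriple T').A.mem_graph
      ⟨e w, (h2 w).1 (LinearPMap.mem_domain_of_mem_graph hm)⟩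
    rw [h3 ⟨w, LinearPMap.mem_domain_of_mem_graph hm⟩ _ rfl,
      ← (LinearPMap.image_iff (LinearPMap.mem_domain_of_mem_graph hm)).2 hm] at hm'
    rw [← hw, hf]
    exact (hX'.mem_graph_toOpTriple hT' (ψ w) (ψ y)).1 hm' (ψ v)
  have d1 : DenseRange X.dom.subtype := by
    rw [DenseRange, Submodule.coe_subtype, Subtype.range_coe]
    exact hX.dense
  have d2 : DenseRange X'.dom.subtype := by
    rw [DenseRange, Submodule.coe_subtype, Subtype.range_coe]
    exact hX'.dense
  let U : X.H ≃ₗᵢ[ℂ] X'.H := ψ.extendOfIsometry X.dom.subtype X'.dom.subtype d1 d2 fun x => by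
    change ‖(ψ x : X'.H)‖ = ‖(x : X.H)‖
    rw [@norm_eq_sqrt_re_inner ℂ, @norm_eq_sqrt_re_inner ℂ, hinner]
  have hU : ∀ x : X.dom, U x = ψ x := fun x => LinearEquiv.extendOfIsometry_eq ..
  refine ⟨U, fun x => ⟨fun hx => ?_, fun hx => ?_⟩, fun f g f' g' hf' hg' => ?_⟩
  · rw [hU ⟨x, hx⟩]
    exact (ψ ⟨x, hx⟩).2
  · have hx' := hU (ψ.symm ⟨U x, hx⟩)
    rw [ψ.apply_symm_apply] at hx'
    rw [← U.injective hx']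
    exact (ψ.symm ⟨U x, hx⟩).2
  · rw [hU] at hf' hg'
    rw [Subtype.ext hf', Subtype.ext hg', hf]

end FormTriple.IsClosedSymmGapZero

/-! ### The triple on `K₋` and its range restriction -/

namespace KMinus

variable {E : Type u} [NormedAddCommGroup E] [InnerProductSpace ℂ E] [CompleteSpace E]
  {S : E →ₗ.[ℂ] E} {hS : IsBijSelfAdjoint S}

theorem rieszInv_eq {φ : KMinus hS} {g : KPlus hS} (h : ∀ x, inner ℂ g x = φ.eval x) :
    φ.rieszInv = g := by
  rw [rieszInv, LinearIsometryEquiv.symm_apply_eq]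
  exact ContinuousLinearMap.ext fun x => (h x).symm

theorem rieszInv_eq_zero {φ : KMinus hS} (h : φ.rieszInv = 0) : φ = 0 :=
  (LinearIsometryEquiv.map_eq_zero_iff (InnerProductSpace.toDual ℂ (KPlus hS)).symm).1 h

end KMinus

namespace OpTriple

variable {Y : OpTriple.{u}} {J : Y.K →ₗ[ℂ] Y.K} {hJ : IsFundamentalSymmetry Y.form J}
  {S : JSpace hJ →ₗ.[ℂ] JSpace hJ}

theorem IsJNonnegOperator.exists_mem_graph (hY : Y.IsJNonnegOperator) (y : Y.K) :
    ∃ x, (x, y) ∈ Y.A.graph := by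
  obtain ⟨J, hJ⟩ := hY.krein.exists_fundamentalSymmetry
  obtain ⟨R, -, hR⟩ := hY.invertible J hJ
  obtain ⟨h, e⟩ := hR (JSpace.of hJ y)
  exact ⟨_, (LinearPMap.mem_graph_iff _).2 ⟨⟨_, h⟩, rfl, e⟩⟩

/-- J-self-adjointness in terms of the form. -/
theorem IsJNonnegOperator.mem_graph_iff (hY : Y.IsJNonnegOperator) (x y : Y.K) :
    (x, y) ∈ Y.A.graph ↔ ∀ z w, (z, w) ∈ Y.A.graph → Y.form x w = Y.form y z := by
  obtain ⟨J, hJ⟩ := hY.krein.exists_fundamentalSymmetry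
  have hsa := hY.selfAdjoint J hJ
  -- `A x = y` is read as `(J A) x = J y`, where self-adjointness allows testing against the graph.
  rw [← hJ.involutive y, ← mem_graph_opJA hJ, hJ.involutive]
  have hJA : ∀ z w, (z, w) ∈ Y.A.graph →
      (JSpace.of hJ z, JSpace.of hJ (J w)) ∈ (Y.opJA hJ).graph := fun z w h => by
    rwa [mem_graph_opJA, hJ.involutive]
  constructor
  · intro h z w hzw
    have h1 := inner_eq_of_mem_graph (isFormalAdjoint_of_isSelfAdjoint hsa) h (hJA z w hzw)
    rw [hJ.apply_eq_inner y z]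
    refine Eq.trans ?_ h1.symm
    rw [← hJ.apply_left_eq_inner, hJ.apply_left_eq_apply_right, hJ.involutive]
  · intro h
    refine mem_graph_of_isSelfAdjoint hsa fun b => ?_
    have key : ∀ z w, (JSpace.of hJ z, JSpace.of hJ w) ∈ (Y.opJA hJ).graph →
        inner ℂ (JSpace.of hJ (J y)) (JSpace.of hJ z) =
          inner ℂ (JSpace.of hJ x) (JSpace.of hJ w) := fun z w hzw => by
      rw [← hJ.apply_eq_inner, ← hJ.apply_left_eq_inner, hJ.apply_left_eq_apply_right]
      exact (h z (J w) ((mem_graph_opJA hJ z w).1 hzw)).symm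
    exact key _ _ ((Y.opJA hJ).mem_graph b)

/-- The inner product of `K₋` against an embedded element of `K`. -/
theorem inner_embed (hS : IsBijSelfAdjoint S) (f : Y.K) (ψ : KMinus hS) :
    inner ℂ (embed hS f) ψ = Y.form f ((JSpace.of hJ).symm (KPlus.incl hS ψ.rieszInv)) := rfl

/-- On `K`, the inner product of `K₋` is `[A⁻¹ ·, ·]`. -/
theorem inner_embed_embed (hY : Y.IsJNonnegOperator) (hS : IsNonnegSqrt S (Y.opJA hJ)) {g v : Y.K}
    (h : (g, v) ∈ Y.A.graph) (y : Y.K) :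
    inner ℂ (embed (hY.sqrt_bij hS) y) (embed (hY.sqrt_bij hS) v) = Y.form y g := by
  have hm : (JSpace.of hJ g, JSpace.of hJ (J v)) ∈ (Y.opJA hJ).graph := by
    rwa [mem_graph_opJA, hJ.involutive]
  obtain ⟨z, h1, h2⟩ := (hS.sq _ _).1 hm
  obtain ⟨a, ha, rfl⟩ := (LinearPMap.mem_graph_iff _).1 h1
  -- The Riesz representative of `[·, v]` is `g = A⁻¹ v`: since `S (S g) = J v`, moving `S` across
  -- gives `{S g, S x} = {J v, x} = [v, x]`.
  have hr : (embed (hY.sqrt_bij hS) v).rieszInv = KPlus.of (hY.sqrt_bij hS) a := by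
    refine KMinus.rieszInv_eq fun x => ?_
    obtain ⟨x, rfl⟩ := (KPlus.of (hY.sqrt_bij hS)).surjective x
    rw [FormSpace.inner_of, plusForm_apply]
    refine Eq.trans ?_ (hJ.apply_eq_inner v ((JSpace.of hJ).symm (x : JSpace hJ))).symm
    exact (inner_eq_of_mem_graph (isFormalAdjoint_of_isSelfAdjoint hS.selfAdjoint) h2
      (S.mem_graph x)).symm
  rw [inner_embed, hr]
  exact congrArg (Y.form y) ha

/-- The formal adjoint is `ψ ↦ J' A₋⁻¹ ψ`, defined on all of `K₋`. The symmetry `J'` need not be the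
`J` from which `K₋` is built, as the gap point condition ranges over all of them. -/
theorem continuous_embed (hS : IsBijSelfAdjoint S) {J' : Y.K →ₗ[ℂ] Y.K}
    (hJ' : IsFundamentalSymmetry Y.form J') :
    Continuous fun x : JSpace hJ' => embed hS ((JSpace.of hJ').symm x) := by
  refine continuous_of_exists_formal_adjoint
    ((embed hS) ∘ₗ (JSpace.of hJ').symm.toLinearMap) fun ψ => ?_
  refine ⟨JSpace.of hJ' (J' ((JSpace.of hJ).symm (KPlus.incl hS ψ.rieszInv))), fun x => ?_⟩
  obtain ⟨x, rfl⟩ := (JSpace.of hJ').surjective x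
  rw [← hJ'.apply_eq_inner, ← inner_conj_symm, ← hJ'.symm]
  rfl

/-- If `ψ` is orthogonal to `K`, then `A₋⁻¹ ψ` is `[·, ·]`-orthogonal to `K` and vanishes by
nondegeneracy. -/
theorem dense_range_embed (hS : IsBijSelfAdjoint S) :
    Dense (LinearMap.range (embed hS) : Set (KMinus hS)) := by
  rw [Submodule.dense_iff_topologicalClosure_eq_top, Submodule.topologicalClosure_eq_top_iff,
    Submodule.eq_bot_iff]
  intro ψ hψ
  refine KMinus.rieszInv_eq_zero ?_
  have h1 : ∀ f : Y.K, Y.form f ((JSpace.of hJ).symm (KPlus.incl hS ψ.rieszInv)) = 0 := fun f => by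
    rw [← inner_embed]
    exact (Submodule.mem_orthogonal _ _).1 hψ _ ⟨f, rfl⟩
  have h2 : (JSpace.of hJ).symm (KPlus.incl hS ψ.rieszInv) = 0 :=
    hJ.eq_zero_of_forall fun f => by rw [← hJ.symm, h1, map_zero]
  exact (KPlus.of hS).symm.map_eq_zero_iff.1 (Subtype.ext ((LinearEquiv.map_eq_zero_iff _).1 h2))

variable (hY : Y.IsJNonnegOperator) (hS : IsNonnegSqrt S (Y.opJA hJ))

/-- The identification of `K` with the domain of the form of `toFormTriple`. -/
noncomputable def domEquiv : Y.K ≃ₗ[ℂ] (toFormTriple hY hS).dom := embedEquiv (hY.sqrt_bij hS)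

theorem form_domEquiv (x y : Y.K) :
    (toFormTriple hY hS).form (domEquiv hY hS x) (domEquiv hY hS y) = Y.form x y := by
  change Y.form ((domEquiv hY hS).symm (domEquiv hY hS x))
    ((domEquiv hY hS).symm (domEquiv hY hS y)) = _
  rw [LinearEquiv.symm_apply_apply, LinearEquiv.symm_apply_apply]

theorem isGapPoint_toFormTriple : (toFormTriple hY hS).IsGapPoint 0 := by
  refine FormTriple.isGapPoint_zero_iff.2
    ⟨hY.krein.of_equiv (domEquiv hY hS) fun x y => (form_domEquiv hY hS x y).symm,
      fun J' hJ' => ?_⟩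
  -- The given symmetry lives on the image of `K` in `K₋`. Pulled back to `K`, it has an isometric
  -- Hilbert space, and `continuous_embed` applies.
  have hJ'' := hJ'.of_equiv (C := Y.form) (domEquiv hY hS).symm fun x y => by
    rw [← form_domEquiv hY hS, LinearEquiv.apply_symm_apply, LinearEquiv.apply_symm_apply]
  have key : ∀ x y : (toFormTriple hY hS).dom,
      Y.form ((domEquiv hY hS).symm (J' (domEquiv hY hS ((domEquiv hY hS).symm x))))
        ((domEquiv hY hS).symm y) = (toFormTriple hY hS).form (J' x) y := fun x y => by
    rw [LinearEquiv.apply_symm_apply]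
    rfl
  let f : JSpace hJ' ≃ₗᵢ[ℂ] JSpace hJ'' :=
    ((JSpace.of hJ').symm.trans ((domEquiv hY hS).symm.trans (JSpace.of hJ''))).isometryOfInner
      fun x y => key _ _
  have h1 := (continuous_embed (hY.sqrt_bij hS) hJ'').comp f.continuous
  have h2 : (fun x : JSpace hJ' =>
      (((JSpace.of hJ').symm x : (toFormTriple hY hS).dom) : (toFormTriple hY hS).H)) =
      (fun x : JSpace hJ'' => embed (hY.sqrt_bij hS) ((JSpace.of hJ'').symm x)) ∘ f := by
    funext x
    exact congrArg Subtype.val ((domEquiv hY hS).apply_symm_apply ((JSpace.of hJ').symm x)).symm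
  rw [h2]
  exact h1

theorem isClosedSymmGapZero_toFormTriple : (toFormTriple hY hS).IsClosedSymmGapZero where
  dense := dense_range_embed (hY.sqrt_bij hS)
  symm _ _ := hJ.symm _ _
  closed := ⟨0, isGapPoint_toFormTriple hY hS⟩
  gap := isGapPoint_toFormTriple hY hS

/-- The range restriction of the representing operator of `(K₋, {·, ·}₋, [·, ·])` is `A`. -/
theorem identified_toOpTriple_toFormTriple
    {T : (toFormTriple hY hS).H →ₗ.[ℂ] (toFormTriple hY hS).H}
    (hT : (toFormTriple hY hS).IsRepresentingOperator T) :
    ((toFormTriple hY hS).toOpTriple T).Identified Y := by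
  refine Identified.of_graph (Y := (toFormTriple hY hS).toOpTriple T) (domEquiv hY hS).symm
    (fun x y => rfl) fun x y => ?_
  obtain ⟨x, rfl⟩ := (domEquiv hY hS).surjective x
  obtain ⟨y, rfl⟩ := (domEquiv hY hS).surjective y
  refine ((isClosedSymmGapZero_toFormTriple hY hS).mem_graph_toOpTriple hT _ _).trans ?_
  change _ ↔ ((domEquiv hY hS).symm (domEquiv hY hS x),
    (domEquiv hY hS).symm (domEquiv hY hS y)) ∈ Y.A.graph
  rw [LinearEquiv.symm_apply_apply, LinearEquiv.symm_apply_apply, hY.mem_graph_iff]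
  -- As `A` is onto, testing against all `w ∈ K` is testing against all pairs `(z, w)` of its graph.
  -- There the inner product of `y` and `w` in `K₋` is the form value of `y` and `z`, so both
  -- conditions agree.
  constructor
  · intro h z w hzw
    have h1 := h (domEquiv hY hS w)
    rw [form_domEquiv] at h1
    exact h1.trans (inner_embed_embed hY hS hzw y)
  · intro h v
    obtain ⟨w, rfl⟩ := (domEquiv hY hS).surjective v
    obtain ⟨z, hz⟩ := hY.exists_mem_graph w
    rw [form_domEquiv, h z w hz]
    exact (inner_embed_embed hY hS hz y).symm

end OpTriple

end KreinForms

/-! ### The bijection and its inverse -/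

open KreinForms in
theorem mainTheorem1 :
    ∃ Φ : Quotient ClosedForm.setoid.{u} ≃ Quotient JNonnegOp.setoid.{u},
      (∀ X : ClosedForm.{u},
        ∃ T : X.1.H →ₗ.[ℂ] X.1.H, X.1.IsRepresentingOperator T ∧
          (∀ T' : X.1.H →ₗ.[ℂ] X.1.H, X.1.IsRepresentingOperator T' → T' = T) ∧
          ∃ h : (X.1.toOpTriple T).IsJNonnegOperator,
            Φ (Quotient.mk _ X) = Quotient.mk _ ⟨X.1.toOpTriple T, h⟩) ∧
      (∀ (Y : JNonnegOp.{u}) (J : Y.1.K →ₗ[ℂ] Y.1.K) (hJ : IsFundamentalSymmetry Y.1.form J),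
        ∃ (S : JSpace hJ →ₗ.[ℂ] JSpace hJ) (hS : IsNonnegSqrt S (Y.1.opJA hJ)),
          (∀ S' : JSpace hJ →ₗ.[ℂ] JSpace hJ, IsNonnegSqrt S' (Y.1.opJA hJ) → S' = S) ∧
          ∃ h : (OpTriple.toFormTriple Y.2 hS).IsClosedSymmGapZero,
            Φ.symm (Quotient.mk _ Y) = Quotient.mk _ ⟨OpTriple.toFormTriple Y.2 hS, h⟩) := by
  choose T hT using fun X : ClosedForm.{u} => X.2.exists_representingOperator
  let F : ClosedForm.{u} → JNonnegOp.{u} := fun X =>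
    ⟨X.1.toOpTriple (T X), X.2.isJNonnegOperator (hT X)⟩
  let Φ : Quotient ClosedForm.setoid.{u} → Quotient JNonnegOp.setoid.{u} :=
    Quotient.map F fun X X' h => X.2.identified_toOpTriple X'.2 (hT X) (hT X') h
  -- This holds for every `J`: one choice gives surjectivity, and injectivity then yields the
  -- formula for the inverse with any other.
  have hinv : ∀ (Y : JNonnegOp.{u}) {J : Y.1.K →ₗ[ℂ] Y.1.K}
      {hJ : IsFundamentalSymmetry Y.1.form J} {S : JSpace hJ →ₗ.[ℂ] JSpace hJ}
      (hS : IsNonnegSqrt S (Y.1.opJA hJ)),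
      Φ (Quotient.mk _ ⟨OpTriple.toFormTriple Y.2 hS,
        OpTriple.isClosedSymmGapZero_toFormTriple Y.2 hS⟩) = Quotient.mk _ Y := fun Y _ _ _ hS =>
    Quotient.sound (OpTriple.identified_toOpTriple_toFormTriple Y.2 hS
      (hT ⟨_, OpTriple.isClosedSymmGapZero_toFormTriple Y.2 hS⟩))
  have hsqrt := fun (Y : JNonnegOp.{u}) (J : Y.1.K →ₗ[ℂ] Y.1.K)
      (hJ : IsFundamentalSymmetry Y.1.form J) =>
    existsUnique_nonnegSqrt (Y.2.selfAdjoint J hJ) (Y.2.nonneg J hJ) (Y.2.bijective hJ)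
  have hbij : Function.Bijective Φ := by
    constructor
    · intro a b
      refine Quotient.inductionOn₂ a b fun X X' h => Quotient.sound ?_
      exact X.2.identified_of_toOpTriple X'.2 (hT X) (hT X') (Quotient.exact h)
    · intro b
      refine Quotient.inductionOn b fun Y => ?_
      obtain ⟨J, hJ⟩ := Y.2.krein.exists_fundamentalSymmetry
      obtain ⟨S, hS, -⟩ := hsqrt Y J hJ
      exact ⟨_, hinv Y hS⟩
  refine ⟨Equiv.ofBijective Φ hbij, fun X => ?_, fun Y J hJ => ?_⟩
  · exact ⟨T X, hT X, fun T' hT' => X.2.representingOperator_unique hT' (hT X),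
      X.2.isJNonnegOperator (hT X), rfl⟩
  · obtain ⟨S, hS, huniq⟩ := hsqrt Y J hJ
    refine ⟨S, hS, huniq, OpTriple.isClosedSymmGapZero_toFormTriple Y.2 hS, ?_⟩
    rw [Equiv.symm_apply_eq]
    exact (hinv Y hS).symm
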